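/- Let $p,q$ be coprime integers with $0<p<q$, let $\alpha=\frac pq$, and let $\bigl(\frac xr,\frac ys\bigr)$ be the pair of parents of $\alpha$, i.e. the fractions with $ry-xs=1$, $p=x+y$, $q=r+s$. Put $i(\alpha)=\frac{q-p}{q}$, $r(\alpha)=\frac rq$, $(ir)(\alpha)=\frac sq$. For a rational number $\beta\in(0,1)$ choose an expansion $\beta=[0,a_1,\dots,a_n]=\cfrac{1}{a_1+\cfrac{1}{\ddots+\cfrac1{a_n}}}$ with positive integers $a_1,\dots,a_n$. Let $T(\beta)$ be the standard rational $(2,2)$-tangle diagram: starting from the tangle $0$ (two horizontal arcs) if $n$ is even and from the tangle $\infty$ (two vertical arcs) if $n$ is odd, add for $j=n,n-1,\dots,1$ successively $a_j$ crossings, on the right if $j$ is even and below if $j$ is odd; in every crossing the overpass is the strand from the upper left to the lower right. Let $D(T(\beta))$ be the link diagram obtained by joining the two left end points and the two right end points of $T(\beta)$. If $\beta$ has odd denominator, this is a knot diagram, which is oriented in either way; if $\beta$ has even denominator, it has two components, and it is oriented so that the left and the right closing arc run in opposite vertical directions. Let $\mathrm{wr}(\beta)$ be the writhe of this oriented diagram,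 let $\langle D\rangle\in\mathbb Z[A^{\pm1}]$ be the Kauffman bracket of a diagram $D$, normalised to be $1$ on the circle, with $\langle D\sqcup\bigcirc\rangle=(-A^2-A^{-2})\langle D\rangle$, and with $\langle D\rangle=A\langle D_A\rangle+A^{-1}\langle D_B\rangle$ at each crossing, where $D_A$ joins the two regions that the overpass sweeps out when it is turned counterclockwise towards the underpass and $D_B$ joins the other two, and let $V(\beta)=(-A^3)^{-\mathrm{wr}(\beta)}\langle D(T(\beta))\rangle$ be the Jones polynomial. Put $\mathrm{wt}(\beta)=-a_1+a_2-\cdots+(-1)^na_n$ if $n$ is even and $\mathrm{wt}(\beta)=-a_1+a_2-\cdots+(-1)^na_n+2$ if $n$ is odd, and let $\langle\Gamma_\beta\rangle=(-A^3)^{\mathrm{wt}(\beta)}\langle D(T(\beta))\rangle$ be the Kauffman bracket of the Conway–Coxeter frieze $\Gamma_\beta$ of zigzag type of $\beta$. Write $\overline f$ for the Laurent polynomial obtained from $f$ by replacing $A$ with $A^{-1}$. Then, for all choices of the expansions and of the orientations as above, $$\bigl(\langle\Gamma_\alpha\rangle,\langle\Gamma_{i(\alpha)}\rangle,\langle\Gamma_{r(\alpha)}\rangle,\langle\Gamma_{(ir)(\alpha)}\rangle\bigr)=\bigl(\langle\Gamma_\alpha\rangle,\overline{\langle\Gamma_\alpha\rangle},\langle\Gamma_\alpha\rangle,\overline{\langle\Gamma_\alpha\rangle}\bigr).$$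 Furthermore: (1) If $q$ is odd, then $V(i(\alpha))=V((ir)(\alpha))=\overline{V(\alpha)}$ and $V(r(\alpha))=V(\alpha)$. (2) If $q$ and $x$ are even, then $V(i(\alpha))=V((ir)(\alpha))=(-A^3)^{-\mathrm{wr}(\alpha)-\mathrm{wr}(i(\alpha))}\,\overline{V(\alpha)}$ and $V(r(\alpha))=V(\alpha)$. (3) If $q$ and $y$ are even, then $V(i(\alpha))=(-A^3)^{-\mathrm{wr}(\alpha)-\mathrm{wr}(i(\alpha))}\,\overline{V(\alpha)}$, $V((ir)(\alpha))=\overline{V(\alpha)}$ and $V(r(\alpha))=(-A^3)^{\mathrm{wr}(\alpha)+\mathrm{wr}(i(\alpha))}\,V(\alpha)$. -/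

import Mathlib

/-- The four corners of a disc in the plane, at which the strands of a `(2,2)`-tangle diagram, or
the four branches at a crossing, end. -/
inductive Corner : Type
  | nw | ne | sw | se
  deriving DecidableEq

instance : Fintype Corner := ⟨{.nw, .ne, .sw, .se}, by intro c; cases c <;> decide⟩

/-- The marked points of a tangle diagram with `n` crossings. A small disc is drawn around every
crossing: `(some k, c)` is the corner `c` of the disc of the `k`-th crossing, and `(none, c)` is
the corner `c` of the outer disc of the tangle, i.e. one of its four end points. -/
abbrev TPoint (n : ℕ) : Type := Option (Fin n) × Corner

/-- A (combinatorial) `(2,2)`-tangle diagram. At each crossing the two strands join opposite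
corners; `nwOver k = true` if the overpass of the crossing `k` is the strand `nw`--`se`, and
`nwOver k = false` if it is the strand `sw`--`ne`. The list `arcs` holds the end points of the
crossingless arcs of the diagram outside the discs of the crossings. -/
structure TangleDiagram : Type where
  n : ℕ
  nwOver : Fin n → Bool
  arcs : List (TPoint n × TPoint n)

namespace TangleDiagram

/-- The tangle diagram `0`: two horizontal arcs. -/
def zero : TangleDiagram where
  n := 0
  nwOver := fun _ => true
  arcs := [((none, .nw), (none, .ne)), ((none, .sw), (none, .se))]

/-- The tangle diagram `∞`: two vertical arcs. -/
def infinity : TangleDiagram where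
  n := 0
  nwOver := fun _ => true
  arcs := [((none, .nw), (none, .sw)), ((none, .ne), (none, .se))]

/-- When a crossing (which gets the index `0`) is added on the right, the old end points `ne` and
`se` become the corners `nw` and `sw` of the new crossing. -/
def shiftRight {n : ℕ} : TPoint n → TPoint (n + 1)
  | (some k, c) => (some k.succ, c)
  | (none, .nw) => (none, .nw)
  | (none, .sw) => (none, .sw)
  | (none, .ne) => (some 0, .nw)
  | (none, .se) => (some 0, .sw)

/-- When a crossing (which gets the index `0`) is added below, the old end points `sw` and `se`
become the corners `nw` and `ne` of the new crossing. -/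
def shiftBelow {n : ℕ} : TPoint n → TPoint (n + 1)
  | (some k, c) => (some k.succ, c)
  | (none, .nw) => (none, .nw)
  | (none, .ne) => (none, .ne)
  | (none, .sw) => (some 0, .nw)
  | (none, .se) => (some 0, .ne)

/-- The sum of `T` and the one-crossing tangle diagram whose overpass is the strand `nw`--`se`
(the crossing is attached on the right of `T`). -/
def addRight (T : TangleDiagram) : TangleDiagram where
  n := T.n + 1
  nwOver := Fin.cons true T.nwOver
  arcs := ((some 0, .ne), (none, .ne)) :: ((some 0, .se), (none, .se)) ::
    T.arcs.map (Prod.map shiftRight shiftRight)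

/-- The product of `T` and the one-crossing tangle diagram whose overpass is the strand
`nw`--`se` (the crossing is attached below `T`). -/
def addBelow (T : TangleDiagram) : TangleDiagram where
  n := T.n + 1
  nwOver := Fin.cons true T.nwOver
  arcs := ((some 0, .sw), (none, .sw)) :: ((some 0, .se), (none, .se)) ::
    T.arcs.map (Prod.map shiftBelow shiftBelow)

/-- `build true [a₁, …, aₙ]` is the standard tangle diagram of `1/(a₁ + 1/(a₂ + ⋯ + 1/aₙ))`, whose
last twists are `a₁` vertical ones, and `build false [a₁, …, aₙ]` is that of
`a₁ + 1/(a₂ + ⋯ + 1/aₙ)`, whose last twists are `a₁` horizontal ones. -/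
def build : Bool → List ℕ → TangleDiagram
  | true, [] => zero
  | false, [] => infinity
  | true, a :: l => addBelow^[a] (build false l)
  | false, a :: l => addRight^[a] (build true l)

/-- The two arcs outside the tangle which turn a tangle diagram `T` into the link diagram `D(T)`,
the denominator of `T`. -/
def closingArcs (n : ℕ) : List (TPoint n × TPoint n) :=
  [((none, .nw), (none, .sw)), ((none, .ne), (none, .se))]

/-! ### The Kauffman bracket of `D(T)`, as a state sum -/

/-- The two arcs which replace the crossing `k` when it is smoothed: the `A`-smoothing (`a = true`)
joins the two regions swept out by the overpass when it is turned counterclockwise towards the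
underpass, the `B`-smoothing (`a = false`) joins the other two regions. -/
def smoothing (T : TangleDiagram) (k : Fin T.n) (a : Bool) : List (TPoint T.n × TPoint T.n) :=
  if a = T.nwOver k then
    [((some k, .nw), (some k, .ne)), ((some k, .sw), (some k, .se))]
  else
    [((some k, .nw), (some k, .sw)), ((some k, .ne), (some k, .se))]

/-- The points `P` and `Q` are the ends of one of the arcs of the state `s` of `D(T)`. -/
def StateArc (T : TangleDiagram) (s : Fin T.n → Bool) (P Q : TPoint T.n) : Prop :=
  (P, Q) ∈ T.arcs ∨ (P, Q) ∈ closingArcs T.n ∨ ∃ k, (P, Q) ∈ T.smoothing k (s k)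

/-- The number of circles in the state `s` of `D(T)`. -/
noncomputable def circles (T : TangleDiagram) (s : Fin T.n → Bool) : ℕ :=
  Nat.card (Quot (T.StateArc s))

/-- The Kauffman bracket `⟨D(T)⟩`, a Laurent polynomial in `A = LaurentPolynomial.T 1`:
the sum over all states `s` of `A ^ (a(s) - b(s)) * (-A² - A⁻²) ^ (circles of s - 1)`, where
`a(s)` and `b(s)` count the `A`- and the `B`-smoothings. -/
noncomputable def bracket (T : TangleDiagram) : LaurentPolynomial ℤ :=
  ∑ s : Fin T.n → Bool,
    LaurentPolynomial.T (∑ k, if s k = true then (1 : ℤ) else -1) *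
      (-LaurentPolynomial.T 2 - LaurentPolynomial.T (-2)) ^ (T.circles s - 1)

/-! ### Orientations and the writhe of `D(T)` -/

/-- An orientation of the link diagram `D(T)`: `o P = true` if the arc of `arcs` at the
point `P` is directed towards `P`, and `o P = false` if it is directed away from `P`. So a strand
enters the disc of a crossing at the points `(some k, c)` with `o (some k, c) = true` and leaves it
at those with `o (some k, c) = false`. -/
structure IsOrientation (T : TangleDiagram) (o : TPoint T.n → Bool) : Prop where
  arc : ∀ a ∈ T.arcs, o a.1 ≠ o a.2
  closing : ∀ a ∈ closingArcs T.n, o a.1 ≠ o a.2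
  strand_nw_se : ∀ k, o (some k, .nw) ≠ o (some k, .se)
  strand_sw_ne : ∀ k, o (some k, .sw) ≠ o (some k, .ne)

/-- The sign of the crossing `k`. If both strands run from left to right or both from right to
left, the crossing is positive precisely when the overpass is the strand `nw`--`se`; otherwise it
is positive precisely when the overpass is the strand `sw`--`ne`. -/
def crossingSign (T : TangleDiagram) (o : TPoint T.n → Bool) (k : Fin T.n) : ℤ :=
  if (o (some k, .nw) = o (some k, .sw)) ↔ T.nwOver k = true then 1 else -1

/-- The writhe of `D(T)` with the orientation `o`. -/
def writhe (T : TangleDiagram) (o : TPoint T.n → Bool) : ℤ :=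
  ∑ k, T.crossingSign o k

end TangleDiagram

/-- The value of the continued fraction `[0, a₁, …, aₙ] = 1/(a₁ + 1/(a₂ + ⋯ + 1/aₙ))`. -/
def cfValue : List ℕ → ℚ
  | [] => 0
  | a :: l => 1 / ((a : ℚ) + cfValue l)

/-- The weight of `[0, a₁, …, aₙ]`: the alternating sum `-a₁ + a₂ - ⋯ + (-1)ⁿ aₙ`, increased by `2`
if `n` is odd. -/
def cfWeight (l : List ℕ) : ℤ :=
  (∑ j : Fin l.length, (-1) ^ ((j : ℕ) + 1) * (l.get j : ℤ)) + if Odd l.length then 2 else 0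

/-- The Laurent polynomial `(-A³)ᵏ`, for an integer `k`. -/
noncomputable def negACubed (k : ℤ) : LaurentPolynomial ℤ :=
  LaurentPolynomial.C (k.negOnePow : ℤ) * LaurentPolynomial.T (3 * k)

/-- The oriented diagram `D(T(α))` of a rational number `α` in `(0,1)`: a continued fraction
expansion `α = [0, a₁, …, aₙ]` with positive integers `aᵢ`, and an orientation of the diagram it
defines. If the denominator of `α` is odd, `D(T(α))` is a knot diagram, and its orientation does
not matter. If it is even, `D(T(α))` has two components, and the convention is that the two closing
arcs, on the left and on the right of the tangle, run in opposite vertical directions, so that the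
one of the end points `sw` and `se` is the end and the other the beginning of a strand of the
tangle. -/
structure RationalDiagram (α : ℚ) : Type where
  digits : List ℕ
  digits_pos : ∀ a ∈ digits, 0 < a
  value_eq : cfValue digits = α
  orient : TPoint (TangleDiagram.build true digits).n → Bool
  isOrientation : (TangleDiagram.build true digits).IsOrientation orient
  convention : Even α.den → orient (none, .sw) ≠ orient (none, .se)

namespace RationalDiagram

variable {α : ℚ}

/-- The tangle diagram `T(α)`. -/
def tangle (D : RationalDiagram α) : TangleDiagram := TangleDiagram.build true D.digits

/-- The weight `wt(α)`. -/
def wt (D : RationalDiagram α) : ℤ := cfWeight D.digits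

/-- The writhe `wr(α)` of the oriented diagram `D(T(α))`. -/
def wr (D : RationalDiagram α) : ℤ := D.tangle.writhe D.orient

/-- The Kauffman bracket `⟨Γ_α⟩ = (-A³) ^ wt(α) ⟨D(T(α))⟩` of the Conway-Coxeter frieze of zigzag
type of `α`. -/
noncomputable def friezeBracket (D : RationalDiagram α) : LaurentPolynomial ℤ :=
  negACubed D.wt * D.tangle.bracket

/-- The Jones polynomial `V(α) = (-A³) ^ (-wr(α)) ⟨D(T(α))⟩` of the oriented link with the diagram
`D(T(α))`. -/
noncomputable def jones (D : RationalDiagram α) : LaurentPolynomial ℤ :=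
  negACubed (-D.wr) * D.tangle.bracket

end RationalDiagram

/-- The fractions `x/r` and `y/s` are the parents of the fraction `p/q`: they are Farey neighbours,
`x/r < y/s`, and `p/q` is their mediant. -/
structure IsFareyParents (x r y s p q : ℕ) : Prop where
  neighbors : r * y = x * s + 1
  num : p = x + y
  den : q = r + s

/-! ### Every rational number in `(0,1)` has such an oriented diagram -/

namespace TangleDiagram

/-- Two values at the end points of each strand of a tangle diagram differ, if the diagram has a
fraction `p/q`. -/
def Compat (p q : ℕ) (f : Corner → Bool) : Prop :=
  (Even p → f .nw ≠ f .ne ∧ f .sw ≠ f .se) ∧ (Even q → f .nw ≠ f .sw ∧ f .ne ≠ f .se) ∧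
    (Odd p → Odd q → f .nw ≠ f .se ∧ f .ne ≠ f .sw)

/-- All values at the end points of `T` that are compatible with the coprime numbers `p` and `q`
extend to an orientation of `T`. -/
def Orientable (T : TangleDiagram) (p q : ℕ) : Prop :=
  Nat.Coprime p q ∧ ∀ f, Compat p q f → ∃ o : TPoint T.n → Bool, (∀ c, o (none, c) = f c) ∧
    (∀ a ∈ T.arcs, o a.1 ≠ o a.2) ∧ (∀ k, o (some k, .nw) ≠ o (some k, .se)) ∧
    ∀ k, o (some k, .sw) ≠ o (some k, .ne)

theorem orientable_zero : Orientable zero 0 1 :=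
  ⟨by simp, fun f hf => ⟨fun P => f P.2, fun _ => rfl,
    List.forall_mem_cons.2 ⟨(hf.1 (by simp)).1, List.forall_mem_singleton.2 (hf.1 (by simp)).2⟩,
    fun k => k.elim0, fun k => k.elim0⟩⟩

theorem orientable_infinity : Orientable infinity 1 0 :=
  ⟨by simp, fun f hf => ⟨fun P => f P.2, fun _ => rfl,
    List.forall_mem_cons.2 ⟨(hf.2.1 (by simp)).1, List.forall_mem_singleton.2 (hf.2.1 (by simp)).2⟩,
    fun k => k.elim0, fun k => k.elim0⟩⟩

theorem not_even_and_even {p q : ℕ} (h : Nat.Coprime p q) : ¬ (Even p ∧ Even q) :=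
  fun ⟨a, b⟩ => by
    have := Nat.dvd_gcd a.two_dvd b.two_dvd
    rw [h] at this
    omega

theorem Orientable.addRight {T : TangleDiagram} {p q : ℕ} (h : Orientable T p q) :
    Orientable T.addRight (p + q) q := by
  obtain ⟨hc, h⟩ := h
  refine ⟨by simpa using hc, fun f hf => ?_⟩
  obtain ⟨o, ho, ha, h1, h2⟩ := h (fun c => match c with
    | .nw => f .nw | .sw => f .sw | .ne => f .se | .se => f .ne) (by
      have hpq := not_even_and_even hc
      unfold Compat at hf ⊢
      simp only [← Nat.not_even_iff_odd, Nat.even_add] at hf ⊢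
      grind)
  refine ⟨fun P => match P with
    | (none, c) => f c
    | (some k, c) => Fin.cases (motive := fun _ => Bool)
        (match c with | .nw => f .se | .sw => f .ne | .ne => !f .ne | .se => !f .se)
        (fun k => o (some k, c)) k, fun _ => rfl, ?_, ?_, ?_⟩
  · refine List.forall_mem_cons.2 ⟨by simp, List.forall_mem_cons.2 ⟨by simp, ?_⟩⟩
    refine List.forall_mem_map.2 ?_
    have key : ∀ P : TPoint T.n, (match (shiftRight P : TPoint (T.n + 1)) with
        | (none, c) => f c
        | (some k, c) => Fin.cases (motive := fun _ => Bool)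
          (match c with | .nw => f .se | .sw => f .ne | .ne => !f .ne | .se => !f .se)
          (fun k => o (some k, c)) k) = o P := by
      rintro ⟨_ | k, _ | _ | _ | _⟩ <;> simp [shiftRight, ho]
    intro a h
    exact ne_of_eq_of_ne (key a.1) (ne_of_ne_of_eq (ha a h) (key a.2).symm)
  · exact Fin.cases (by simp) h1
  · exact Fin.cases (by simp) h2

theorem Orientable.addBelow {T : TangleDiagram} {p q : ℕ} (h : Orientable T p q) :
    Orientable T.addBelow p (q + p) := by
  obtain ⟨hc, h⟩ := h
  refine ⟨by simpa using hc, fun f hf => ?_⟩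
  obtain ⟨o, ho, ha, h1, h2⟩ := h (fun c => match c with
    | .nw => f .nw | .ne => f .ne | .sw => f .se | .se => f .sw) (by
      have hpq := not_even_and_even hc
      unfold Compat at hf ⊢
      simp only [← Nat.not_even_iff_odd, Nat.even_add] at hf ⊢
      grind)
  refine ⟨fun P => match P with
    | (none, c) => f c
    | (some k, c) => Fin.cases (motive := fun _ => Bool)
        (match c with | .nw => f .se | .ne => f .sw | .sw => !f .sw | .se => !f .se)
        (fun k => o (some k, c)) k, fun _ => rfl, ?_, ?_, ?_⟩
  · refine List.forall_mem_cons.2 ⟨by simp, List.forall_mem_cons.2 ⟨by simp, ?_⟩⟩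
    refine List.forall_mem_map.2 ?_
    have key : ∀ P : TPoint T.n, (match (shiftBelow P : TPoint (T.n + 1)) with
        | (none, c) => f c
        | (some k, c) => Fin.cases (motive := fun _ => Bool)
          (match c with | .nw => f .se | .ne => f .sw | .sw => !f .sw | .se => !f .se)
          (fun k => o (some k, c)) k) = o P := by
      rintro ⟨_ | k, _ | _ | _ | _⟩ <;> simp [shiftBelow, ho]
    intro a h
    exact ne_of_eq_of_ne (key a.1) (ne_of_ne_of_eq (ha a h) (key a.2).symm)
  · exact Fin.cases (by simp) h1
  · exact Fin.cases (by simp) h2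

theorem orientable_build (l : List ℕ) (hl : ∀ a ∈ l, 0 < a) :
    (∃ p q, 0 < q ∧ Orientable (build true l) p q ∧ (p : ℚ) / q = cfValue l) ∧
      ∃ p q, 0 < p ∧ Orientable (build false l) p q ∧ (q : ℚ) / p = cfValue l := by
  induction l with
  | nil => exact ⟨⟨0, 1, by simp, orientable_zero, by simp [cfValue]⟩,
      ⟨1, 0, by simp, orientable_infinity, by simp [cfValue]⟩⟩
  | cons a l ih =>
    obtain ⟨ha, hl⟩ := List.forall_mem_cons.1 hl
    obtain ⟨⟨p, q, hq, h, hv⟩, p', q', hp', h', hv'⟩ := ih hl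
    have e1 : ∀ b, Orientable (TangleDiagram.addBelow^[b] (build false l)) p' (q' + b * p') := by
      intro b
      induction b with
      | zero => simpa using h'
      | succ b ih =>
        rw [Function.iterate_succ_apply', add_mul, one_mul, ← add_assoc]
        exact ih.addBelow
    have e2 : ∀ b, Orientable (TangleDiagram.addRight^[b] (build true l)) (p + b * q) q := by
      intro b
      induction b with
      | zero => simpa using h
      | succ b ih =>
        rw [Function.iterate_succ_apply', add_mul, one_mul, ← add_assoc]
        exact ih.addRight
    refine ⟨⟨p', q' + a * p', by positivity, e1 a, ?_⟩, p + a * q, q, by positivity, e2 a, ?_⟩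
    · have : (p' : ℚ) ≠ 0 := by positivity
      rw [cfValue, ← hv']
      push_cast
      field_simp
      ring
    · have : (q : ℚ) ≠ 0 := by positivity
      rw [cfValue, ← hv]
      push_cast
      field_simp
      ring

end TangleDiagram

theorem exists_cfValue (q p : ℕ) (hp : 0 < p) (hpq : p < q) :
    ∃ l : List ℕ, (∀ a ∈ l, 0 < a) ∧ cfValue l = (p : ℚ) / q := by
  induction p using Nat.strong_induction_on generalizing q with
  | _ p ih =>
    have hdiv : 0 < q / p := Nat.div_pos hpq.le hp
    have hq : (q : ℚ) = p * (q / p : ℕ) + (q % p : ℕ) := by exact_mod_cast (Nat.div_add_mod q p).symm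
    have hp0 : (p : ℚ) ≠ 0 := by positivity
    rcases Nat.eq_zero_or_pos (q % p) with h0 | h0
    · refine ⟨[q / p], by simpa using hdiv, ?_⟩
      rw [cfValue, cfValue, hq, h0]
      field_simp
      simp
    · obtain ⟨l, hl, hv⟩ := ih (q % p) (Nat.mod_lt _ hp) p h0 (Nat.mod_lt _ hp)
      refine ⟨(q / p) :: l, List.forall_mem_cons.2 ⟨hdiv, hl⟩, ?_⟩
      rw [cfValue, hv, hq]
      field_simp

theorem RationalDiagram.nonempty {α : ℚ} (h0 : 0 < α) (h1 : α < 1) :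
    Nonempty (RationalDiagram α) := by
  obtain ⟨l, hl, hv⟩ := exists_cfValue α.den α.num.toNat (by have := Rat.num_pos.2 h0; omega)
    (by
      have : α.num < α.den := by
        rw [← Rat.num_div_den α, div_lt_one (by exact_mod_cast α.den_pos)] at h1
        exact_mod_cast h1
      have := Rat.num_pos.2 h0
      omega)
  have hα : cfValue l = α := by
    rw [hv]
    have : ((α.num.toNat : ℕ) : ℚ) = (α.num : ℚ) := by
      exact_mod_cast Int.toNat_of_nonneg (Rat.num_pos.2 h0).le
    rw [this, Rat.num_div_den]
  obtain ⟨⟨p, q, hq, ⟨hc, h⟩, hpq⟩, -⟩ := TangleDiagram.orientable_build l hl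
  have hden : α.den = q := by
    have := Rat.den_div_eq_of_coprime (a := (p : ℤ)) (b := (q : ℤ)) (by exact_mod_cast hq)
      (by simpa using hc)
    rw [Int.cast_natCast, Int.cast_natCast, hpq, hα] at this
    exact_mod_cast this
  obtain ⟨f, hf, h1, h2, h3⟩ : ∃ f, TangleDiagram.Compat p q f ∧ f .nw ≠ f .sw ∧ f .ne ≠ f .se ∧
      (Even q → f .sw ≠ f .se) := by
    have := TangleDiagram.not_even_and_even hc
    by_cases hp : Odd p ∧ Odd q
    · refine ⟨fun c => match c with | .nw => true | .ne => true | .sw => false | .se => false, ?_⟩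
      simp only [TangleDiagram.Compat, ← Nat.not_even_iff_odd] at hp ⊢
      simp [hp]
    · refine ⟨fun c => match c with | .nw => true | .ne => false | .sw => false | .se => true, ?_⟩
      simp only [TangleDiagram.Compat, ← Nat.not_even_iff_odd] at hp ⊢
      simp
      grind
  obtain ⟨o, ho, ha, hs, hs'⟩ := h f hf
  exact ⟨⟨l, hl, hα, o, ⟨ha, List.forall_mem_cons.2 ⟨by simpa [ho] using h1,
    List.forall_mem_singleton.2 (by simpa [ho] using h2)⟩, hs, hs'⟩, by rw [hden, ho, ho]; exact h3⟩⟩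

/-!
# Kauffman brackets and Jones polynomials under the symmetries of a fraction

The tangle diagram of a fraction in `(0,1)` arises from a single crossing by adding twists on the
right and below, so it is encoded by a word in two letters (`IsTwisted`). A fraction determines its
word by the Euclidean algorithm (`frac_injective`), which makes the chosen continued fraction
irrelevant: the two expansions of a number differ only in whether the first crossing is regarded as
a horizontal or as a vertical twist. If `p/q` has the word `true :: w`, then the product of the
matrices of the letters of `w` has the parents of `p/q` as columns (after the letter `true`), so
that `r/q` has the reversed word, `(q-p)/q` the word with the two letters interchanged, and `s/q`
the word changed in both ways.

Each state of a tangle diagram without the closing arcs consists of circles and two arcs, joined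
like those of the tangle `0` or `∞`. Hence the bracket is `a⟨0⟩ + b⟨∞⟩`, and a crossing acts
linearly on `(a, b)` (`HasCoords`). Normalised by the power of `-A³` in the weight, and up to a
scalar in the second coordinate, the two letters act by the matrices `(1 1; 0 u⁻¹)` and `(u 0; 1 1)`
with `u = -A⁴`. Conjugation with the interchange of the coordinates turns one into the other with
`u` replaced by `u⁻¹`; this is the effect of `i` (`friezePolynomial_map_not`). Both are self-adjoint
for a symmetric bilinear form, for which the initial vector is dual to the closing functional; this
is the invariance under `r` (`friezePolynomial_reverse`).

The Jones polynomials only need the writhes in addition, because the weight is the difference of the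
numbers of the letters of `w`, which is invariant under reversal and changes its sign when the
letters are interchanged. Exactly one of the end points `ne`, `sw`, `se` of an oriented tangle is
directed like `nw`, and each twist permutes these three corners and has a sign that depends on the
corner only. So the writhe is a sum of signs along the path of a corner under the letters of the
word (`IsTwisted.writhe_eq`). Reversal of the word reverses the path (`pathSign_reverse`), and the
interchange of the letters reflects the path and changes all signs (`pathSign_map_not`). It remains
to find the end points of the path, which is the action of the word on fractions modulo `2`
(`run_parityCorner`); the cases of the theorem are the possible end points.
-/

/-! ### The arcs and circles of a state -/

namespace TangleDiagram

/-- The map `g` is constant along the arcs of the state `s` of the tangle diagram `T` (without the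
closing arcs). -/
def Respects (T : TangleDiagram) (s : Fin T.n → Bool) {X : Type} (g : TPoint T.n → X) : Prop :=
  (∀ a ∈ T.arcs, g a.1 = g a.2) ∧ ∀ k, ∀ a ∈ T.smoothing k (s k), g a.1 = g a.2

/-- The state `s` of `T` consists of `k` circles and two arcs, which join the end points vertically
if `v = true` and horizontally if `v = false`. The set of components is presented as
`Fin k ⊕ Bool` by its universal property, where `Sum.inr true` is the arc ending at `nw`, and
`Sum.inr false` the one ending at `se`. -/
def StateShape (T : TangleDiagram) (s : Fin T.n → Bool) (v : Bool) (k : ℕ) : Prop :=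
  ∃ f : TPoint T.n → Fin k ⊕ Bool, T.Respects s f ∧ Function.Surjective f ∧
    (∀ (X : Type) (g : TPoint T.n → X), T.Respects s g →
      ∃ h : Fin k ⊕ Bool → X, ∀ P, g P = h (f P)) ∧
    f (none, .nw) = Sum.inr true ∧ f (none, .se) = Sum.inr false ∧
    f (none, .ne) = Sum.inr (!v) ∧ f (none, .sw) = Sum.inr v

theorem stateShape_zero (s : Fin zero.n → Bool) : zero.StateShape s false 0 := by
  refine ⟨fun P => match P.2 with
    | .nw => Sum.inr true | .ne => Sum.inr true | .sw => Sum.inr false | .se => Sum.inr false,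
    ⟨List.forall_mem_cons.2 ⟨rfl, List.forall_mem_singleton.2 rfl⟩, fun k => k.elim0⟩,
    ?_, ?_, rfl, rfl, rfl, rfl⟩
  · rintro (k | _ | _)
    · exact k.elim0
    · exact ⟨(none, .se), rfl⟩
    · exact ⟨(none, .nw), rfl⟩
  · rintro X g ⟨hg, -⟩
    obtain ⟨e1, hg⟩ := List.forall_mem_cons.1 hg
    have e2 := List.forall_mem_singleton.1 hg
    dsimp only at e1 e2
    refine ⟨Sum.elim (fun k => k.elim0) fun b => g (none, if b then .nw else .se), ?_⟩
    rintro ⟨k | k, c⟩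
    · cases c
      exacts [rfl, e1.symm, e2, rfl]
    · exact k.elim0

theorem stateShape_infinity (s : Fin infinity.n → Bool) : infinity.StateShape s true 0 := by
  refine ⟨fun P => match P.2 with
    | .nw => Sum.inr true | .sw => Sum.inr true | .ne => Sum.inr false | .se => Sum.inr false,
    ⟨List.forall_mem_cons.2 ⟨rfl, List.forall_mem_singleton.2 rfl⟩, fun k => k.elim0⟩,
    ?_, ?_, rfl, rfl, rfl, rfl⟩
  · rintro (k | _ | _)
    · exact k.elim0
    · exact ⟨(none, .se), rfl⟩
    · exact ⟨(none, .nw), rfl⟩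
  · rintro X g ⟨hg, -⟩
    obtain ⟨e1, hg⟩ := List.forall_mem_cons.1 hg
    have e2 := List.forall_mem_singleton.1 hg
    dsimp only at e1 e2
    refine ⟨Sum.elim (fun k => k.elim0) fun b => g (none, if b then .nw else .se), ?_⟩
    rintro ⟨k | k, c⟩
    · cases c
      exacts [rfl, e2, e1.symm, rfl]
    · exact k.elim0

/-- The map on the marked points after a crossing has been added on the right which extends `g` and
has the values `x` and `y` on the arcs from the new crossing to the end points `ne` and `se`. -/
def extendRight {n : ℕ} {X : Type} (g : TPoint n → X) (x y : X) : TPoint (n + 1) → X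
  | (none, .nw) => g (none, .nw)
  | (none, .sw) => g (none, .sw)
  | (none, .ne) => x
  | (none, .se) => y
  | (some k, c) => Fin.cases (motive := fun _ => X)
      (match c with | .nw => g (none, .ne) | .sw => g (none, .se) | .ne => x | .se => y)
      (fun k => g (some k, c)) k

/-- The analogue of `extendRight` for a crossing added below, with the values `x` and `y` on the
arcs from the new crossing to the end points `sw` and `se`. -/
def extendBelow {n : ℕ} {X : Type} (g : TPoint n → X) (x y : X) : TPoint (n + 1) → X
  | (none, .nw) => g (none, .nw)
  | (none, .ne) => g (none, .ne)
  | (none, .sw) => x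
  | (none, .se) => y
  | (some k, c) => Fin.cases (motive := fun _ => X)
      (match c with | .nw => g (none, .sw) | .ne => g (none, .se) | .sw => x | .se => y)
      (fun k => g (some k, c)) k

@[simp] theorem extendRight_shiftRight {n : ℕ} {X : Type} (g : TPoint n → X) (x y : X)
    (P : TPoint n) : extendRight g x y (shiftRight P) = g P := by
  rcases P with ⟨_ | k, _ | _ | _ | _⟩ <;> rfl

@[simp] theorem extendBelow_shiftBelow {n : ℕ} {X : Type} (g : TPoint n → X) (x y : X)
    (P : TPoint n) : extendBelow g x y (shiftBelow P) = g P := by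
  rcases P with ⟨_ | k, _ | _ | _ | _⟩ <;> rfl

theorem eq_extendRight {n : ℕ} {X : Type} (g : TPoint (n + 1) → X)
    (hne : g (some 0, .ne) = g (none, .ne)) (hse : g (some 0, .se) = g (none, .se))
    (P : TPoint (n + 1)) :
    g P = extendRight (fun P => g (shiftRight P)) (g (none, .ne)) (g (none, .se)) P := by
  rcases P with ⟨_ | k, c⟩
  · cases c <;> rfl
  · refine Fin.cases ?_ (fun k => ?_) k
    · cases c <;> first | rfl | assumption
    · rfl

theorem eq_extendBelow {n : ℕ} {X : Type} (g : TPoint (n + 1) → X)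
    (hsw : g (some 0, .sw) = g (none, .sw)) (hse : g (some 0, .se) = g (none, .se))
    (P : TPoint (n + 1)) :
    g P = extendBelow (fun P => g (shiftBelow P)) (g (none, .sw)) (g (none, .se)) P := by
  rcases P with ⟨_ | k, c⟩
  · cases c <;> rfl
  · refine Fin.cases ?_ (fun k => ?_) k
    · cases c <;> first | rfl | assumption
    · rfl

theorem smoothing_addRight_succ (T : TangleDiagram) (k : Fin T.n) (a : Bool) :
    T.addRight.smoothing k.succ a = (T.smoothing k a).map (Prod.map shiftRight shiftRight) := by
  have h : T.addRight.nwOver k.succ = T.nwOver k := rfl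
  unfold smoothing
  rw [h]
  split <;> rfl

theorem smoothing_addBelow_succ (T : TangleDiagram) (k : Fin T.n) (a : Bool) :
    T.addBelow.smoothing k.succ a = (T.smoothing k a).map (Prod.map shiftBelow shiftBelow) := by
  have h : T.addBelow.nwOver k.succ = T.nwOver k := rfl
  unfold smoothing
  rw [h]
  split <;> rfl

theorem respects_addRight_iff (T : TangleDiagram) (b : Bool) (s : Fin T.n → Bool) {X : Type}
    (g : TPoint (T.n + 1) → X) :
    T.addRight.Respects (Fin.cons b s) g ↔
      T.Respects s (fun P => g (shiftRight P)) ∧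
      (g (some 0, .ne) = g (none, .ne) ∧ g (some 0, .se) = g (none, .se)) ∧
      if b then g (some 0, .nw) = g (some 0, .ne) ∧ g (some 0, .sw) = g (some 0, .se)
        else g (some 0, .nw) = g (some 0, .sw) ∧ g (some 0, .ne) = g (some 0, .se) := by
  have h0 : (∀ a ∈ T.addRight.smoothing (0 : Fin (T.n + 1)) b, g a.1 = g a.2) ↔
      if b then g (some 0, .nw) = g (some 0, .ne) ∧ g (some 0, .sw) = g (some 0, .se)
        else g (some 0, .nw) = g (some 0, .sw) ∧ g (some 0, .ne) = g (some 0, .se) := by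
    cases b <;>
    exact List.forall_mem_cons.trans (and_congr Iff.rfl List.forall_mem_singleton)
  have h1 (k : Fin T.n) : (∀ a ∈ T.addRight.smoothing k.succ (s k), g a.1 = g a.2) ↔
      ∀ a ∈ T.smoothing k (s k), g (shiftRight a.1) = g (shiftRight a.2) := by
    rw [smoothing_addRight_succ]
    exact List.forall_mem_map
  have h2 : (∀ a ∈ T.addRight.arcs, g a.1 = g a.2) ↔ g (some 0, .ne) = g (none, .ne) ∧
      g (some 0, .se) = g (none, .se) ∧
      ∀ a ∈ T.arcs, g (shiftRight a.1) = g (shiftRight a.2) :=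
    List.forall_mem_cons.trans (and_congr Iff.rfl
      (List.forall_mem_cons.trans (and_congr Iff.rfl List.forall_mem_map)))
  have h3 : T.addRight.Respects (Fin.cons b s) g ↔ _ :=
    and_congr h2 (Fin.forall_fin_succ.trans (and_congr h0 (forall_congr' h1)))
  rw [h3, Respects]
  tauto

theorem respects_addBelow_iff (T : TangleDiagram) (b : Bool) (s : Fin T.n → Bool) {X : Type}
    (g : TPoint (T.n + 1) → X) :
    T.addBelow.Respects (Fin.cons b s) g ↔
      T.Respects s (fun P => g (shiftBelow P)) ∧
      (g (some 0, .sw) = g (none, .sw) ∧ g (some 0, .se) = g (none, .se)) ∧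
      if b then g (some 0, .nw) = g (some 0, .ne) ∧ g (some 0, .sw) = g (some 0, .se)
        else g (some 0, .nw) = g (some 0, .sw) ∧ g (some 0, .ne) = g (some 0, .se) := by
  have h0 : (∀ a ∈ T.addBelow.smoothing (0 : Fin (T.n + 1)) b, g a.1 = g a.2) ↔
      if b then g (some 0, .nw) = g (some 0, .ne) ∧ g (some 0, .sw) = g (some 0, .se)
        else g (some 0, .nw) = g (some 0, .sw) ∧ g (some 0, .ne) = g (some 0, .se) := by
    cases b <;>
    exact List.forall_mem_cons.trans (and_congr Iff.rfl List.forall_mem_singleton)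
  have h1 (k : Fin T.n) : (∀ a ∈ T.addBelow.smoothing k.succ (s k), g a.1 = g a.2) ↔
      ∀ a ∈ T.smoothing k (s k), g (shiftBelow a.1) = g (shiftBelow a.2) := by
    rw [smoothing_addBelow_succ]
    exact List.forall_mem_map
  have h2 : (∀ a ∈ T.addBelow.arcs, g a.1 = g a.2) ↔ g (some 0, .sw) = g (none, .sw) ∧
      g (some 0, .se) = g (none, .se) ∧
      ∀ a ∈ T.arcs, g (shiftBelow a.1) = g (shiftBelow a.2) :=
    List.forall_mem_cons.trans (and_congr Iff.rfl
      (List.forall_mem_cons.trans (and_congr Iff.rfl List.forall_mem_map)))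
  have h3 : T.addBelow.Respects (Fin.cons b s) g ↔ _ :=
    and_congr h2 (Fin.forall_fin_succ.trans (and_congr h0 (forall_congr' h1)))
  rw [h3, Respects]
  tauto

theorem Respects.comp {T : TangleDiagram} {s : Fin T.n → Bool} {X Y : Type} {g : TPoint T.n → X}
    (hg : T.Respects s g) (φ : X → Y) : T.Respects s (fun P => φ (g P)) :=
  ⟨fun a ha => congrArg φ (hg.1 a ha), fun k a ha => congrArg φ (hg.2 k a ha)⟩

/-- The smoothing of a crossing on the right that continues the end points `ne` and `se` does not
change the shape of a state. -/
theorem StateShape.addRight_true {T : TangleDiagram} {s : Fin T.n → Bool} {v : Bool} {k : ℕ}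
    (h : T.StateShape s v k) : T.addRight.StateShape (Fin.cons true s) v k := by
  obtain ⟨f, hr, hs, hu, h1, h2, h3, h4⟩ := h
  refine ⟨extendRight f (f (none, .ne)) (f (none, .se)), ?_, ?_, ?_, h1, h2, h3, h4⟩
  · refine (respects_addRight_iff T _ s _).2 ?_
    simp only [extendRight_shiftRight]
    exact ⟨hr, ⟨rfl, rfl⟩, rfl, rfl⟩
  · intro q
    obtain ⟨P, rfl⟩ := hs q
    exact ⟨shiftRight P, by simp⟩
  · intro X (g : TPoint (T.n + 1) → X) hg
    obtain ⟨hg, ⟨e1, e2⟩, e3, e4⟩ := (respects_addRight_iff T _ s g).1 hg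
    obtain ⟨φ, hφ⟩ := hu X _ hg
    refine ⟨φ, fun (P : TPoint (T.n + 1)) => ?_⟩
    have e5 : g (none, .ne) = φ (f (none, .ne)) := e1.symm.trans (e3.symm.trans (hφ (none, .ne)))
    have e6 : g (none, .se) = φ (f (none, .se)) := e2.symm.trans (e4.symm.trans (hφ (none, .se)))
    rw [eq_extendRight g e1 e2 P, e5, e6]
    simp only [hφ]
    rcases P with ⟨_ | k, c⟩
    · cases c <;> rfl
    · refine Fin.cases ?_ (fun k => rfl) k
      cases c <;> rfl

/-- The other smoothing of a crossing on the right joins the end points `ne` and `se` of `T`, and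
the two new end points. If the two arcs of the state are horizontal, they become one. -/
theorem StateShape.addRight_false {T : TangleDiagram} {s : Fin T.n → Bool} {k : ℕ}
    (h : T.StateShape s false k) : T.addRight.StateShape (Fin.cons false s) true k := by
  obtain ⟨f, hr, hs, hu, h1, h2, h3, h4⟩ := h
  set ψ : Fin k ⊕ Bool → Fin k ⊕ Bool := Sum.map id (fun _ => true) with hψ
  refine ⟨extendRight (fun P => ψ (f P)) (Sum.inr false) (Sum.inr false), ?_, ?_, ?_,
    by simp [extendRight, h1, hψ], rfl, rfl, by simp [extendRight, h4, hψ]⟩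
  · refine (respects_addRight_iff T _ s _).2 ?_
    simp only [extendRight_shiftRight]
    exact ⟨hr.comp ψ, ⟨rfl, rfl⟩, by simp [extendRight, h3, h2, hψ], rfl⟩
  · rintro (q | _ | _)
    · obtain ⟨P, hP⟩ := hs (Sum.inl q)
      exact ⟨shiftRight P, by simp [hP, hψ]⟩
    · exact ⟨(none, .ne), rfl⟩
    · exact ⟨(none, .nw), by simp [extendRight, h1, hψ]⟩
  · intro X (g : TPoint (T.n + 1) → X) hg
    obtain ⟨hg, ⟨e1, e2⟩, e3, e4⟩ := (respects_addRight_iff T _ s g).1 hg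
    obtain ⟨φ, hφ⟩ := hu X _ hg
    have e5 : φ (Sum.inr true) = φ (Sum.inr false) := by
      rw [← h2, show Sum.inr true = f (none, .ne) from h3.symm]
      exact (hφ _).symm.trans (e3.trans (hφ (none, .se)))
    have e6 : g (none, .se) = g (none, .ne) := e2.symm.trans (e4.symm.trans e1)
    have e7 : ∀ q, φ q = Sum.elim (fun i => φ (Sum.inl i))
        (fun b => if b then φ (Sum.inr true) else g (none, .ne)) (ψ q) := by
      rintro (q | _ | _) <;> simp [hψ, e5]
    refine ⟨Sum.elim (fun i => φ (Sum.inl i))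
      fun b => if b then φ (Sum.inr true) else g (none, .ne), fun (P : TPoint (T.n + 1)) => ?_⟩
    rw [eq_extendRight g e1 e2 P, e6]
    simp only [hφ]
    rcases P with ⟨_ | k, c⟩
    · cases c <;> first | rfl | exact e7 _
    · refine Fin.cases ?_ (fun k => e7 _) k
      cases c <;> first | rfl | exact e7 _

/-- If the two arcs of a state are vertical, the one on the right is closed to a circle. -/
theorem StateShape.addRight_false_of_true {T : TangleDiagram} {s : Fin T.n → Bool} {k : ℕ}
    (h : T.StateShape s true k) : T.addRight.StateShape (Fin.cons false s) true (k + 1) := by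
  obtain ⟨f, hr, hs, hu, h1, h2, h3, h4⟩ := h
  set ψ : Fin k ⊕ Bool → Fin (k + 1) ⊕ Bool :=
    Sum.elim (fun i => Sum.inl i.succ) (fun b => if b then Sum.inr true else Sum.inl 0) with hψ
  refine ⟨extendRight (fun P => ψ (f P)) (Sum.inr false) (Sum.inr false), ?_, ?_, ?_,
    by simp [extendRight, h1, hψ], rfl, rfl, by simp [extendRight, h4, hψ]⟩
  · refine (respects_addRight_iff T _ s _).2 ?_
    simp only [extendRight_shiftRight]
    exact ⟨hr.comp ψ, ⟨rfl, rfl⟩, by simp [extendRight, h3, h2], rfl⟩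
  · rintro (q | _ | _)
    · refine Fin.cases ⟨shiftRight (none, .se), by simp [h2, hψ]⟩ (fun q => ?_) q
      obtain ⟨P, hP⟩ := hs (Sum.inl q)
      exact ⟨shiftRight P, by simp [hP, hψ]⟩
    · exact ⟨(none, .ne), rfl⟩
    · exact ⟨(none, .nw), by simp [extendRight, h1, hψ]⟩
  · intro X (g : TPoint (T.n + 1) → X) hg
    obtain ⟨hg, ⟨e1, e2⟩, e3, e4⟩ := (respects_addRight_iff T _ s g).1 hg
    obtain ⟨φ, hφ⟩ := hu X _ hg
    have e6 : g (none, .se) = g (none, .ne) := e2.symm.trans (e4.symm.trans e1)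
    set χ : Fin (k + 1) ⊕ Bool → X := Sum.elim (Fin.cons (φ (Sum.inr false)) fun i => φ (Sum.inl i))
        (fun b => if b then φ (Sum.inr true) else g (none, .ne)) with hχ
    have e7 : ∀ q, φ q = χ (ψ q) := by
      rintro (q | _ | _) <;> simp [hψ, hχ]
    refine ⟨χ, fun (P : TPoint (T.n + 1)) => ?_⟩
    rw [eq_extendRight g e1 e2 P, e6]
    simp only [hφ]
    rcases P with ⟨_ | k, c⟩
    · cases c <;> first | rfl | exact e7 _
    · refine Fin.cases ?_ (fun k => e7 _) k
      cases c <;> first | rfl | exact e7 _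

/-- The smoothing of a crossing below that continues the end points `sw` and `se` does not change
the shape of a state. -/
theorem StateShape.addBelow_false {T : TangleDiagram} {s : Fin T.n → Bool} {v : Bool} {k : ℕ}
    (h : T.StateShape s v k) : T.addBelow.StateShape (Fin.cons false s) v k := by
  obtain ⟨f, hr, hs, hu, h1, h2, h3, h4⟩ := h
  refine ⟨extendBelow f (f (none, .sw)) (f (none, .se)), ?_, ?_, ?_, h1, h2, h3, h4⟩
  · refine (respects_addBelow_iff T _ s _).2 ?_
    simp only [extendBelow_shiftBelow]
    exact ⟨hr, ⟨rfl, rfl⟩, rfl, rfl⟩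
  · intro q
    obtain ⟨P, rfl⟩ := hs q
    exact ⟨shiftBelow P, by simp⟩
  · intro X (g : TPoint (T.n + 1) → X) hg
    obtain ⟨hg, ⟨e1, e2⟩, e3, e4⟩ := (respects_addBelow_iff T _ s g).1 hg
    obtain ⟨φ, hφ⟩ := hu X _ hg
    refine ⟨φ, fun (P : TPoint (T.n + 1)) => ?_⟩
    have e5 : g (none, .sw) = φ (f (none, .sw)) := e1.symm.trans (e3.symm.trans (hφ (none, .sw)))
    have e6 : g (none, .se) = φ (f (none, .se)) := e2.symm.trans (e4.symm.trans (hφ (none, .se)))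
    rw [eq_extendBelow g e1 e2 P, e5, e6]
    simp only [hφ]
    rcases P with ⟨_ | k, c⟩
    · cases c <;> rfl
    · refine Fin.cases ?_ (fun k => rfl) k
      cases c <;> rfl

/-- The other smoothing of a crossing below joins the end points `sw` and `se` of `T`, and the two
new end points. If the two arcs of the state are vertical, they become one. -/
theorem StateShape.addBelow_true {T : TangleDiagram} {s : Fin T.n → Bool} {k : ℕ}
    (h : T.StateShape s true k) : T.addBelow.StateShape (Fin.cons true s) false k := by
  obtain ⟨f, hr, hs, hu, h1, h2, h3, h4⟩ := h
  set ψ : Fin k ⊕ Bool → Fin k ⊕ Bool := Sum.map id (fun _ => true) with hψ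
  refine ⟨extendBelow (fun P => ψ (f P)) (Sum.inr false) (Sum.inr false), ?_, ?_, ?_,
    by simp [extendBelow, h1, hψ], rfl, by simp [extendBelow, h3, hψ], rfl⟩
  · refine (respects_addBelow_iff T _ s _).2 ?_
    simp only [extendBelow_shiftBelow]
    exact ⟨hr.comp ψ, ⟨rfl, rfl⟩, by simp [extendBelow, h4, h2, hψ], rfl⟩
  · rintro (q | _ | _)
    · obtain ⟨P, hP⟩ := hs (Sum.inl q)
      exact ⟨shiftBelow P, by simp [hP, hψ]⟩
    · exact ⟨(none, .sw), rfl⟩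
    · exact ⟨(none, .nw), by simp [extendBelow, h1, hψ]⟩
  · intro X (g : TPoint (T.n + 1) → X) hg
    obtain ⟨hg, ⟨e1, e2⟩, e3, e4⟩ := (respects_addBelow_iff T _ s g).1 hg
    obtain ⟨φ, hφ⟩ := hu X _ hg
    have e5 : φ (Sum.inr true) = φ (Sum.inr false) := by
      rw [← h2, ← h4]
      exact (hφ _).symm.trans (e3.trans (hφ (none, .se)))
    have e6 : g (none, .se) = g (none, .sw) := e2.symm.trans (e4.symm.trans e1)
    have e7 : ∀ q, φ q = Sum.elim (fun i => φ (Sum.inl i))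
        (fun b => if b then φ (Sum.inr true) else g (none, .sw)) (ψ q) := by
      rintro (q | _ | _) <;> simp [hψ, e5]
    refine ⟨Sum.elim (fun i => φ (Sum.inl i))
      fun b => if b then φ (Sum.inr true) else g (none, .sw), fun (P : TPoint (T.n + 1)) => ?_⟩
    rw [eq_extendBelow g e1 e2 P, e6]
    simp only [hφ]
    rcases P with ⟨_ | k, c⟩
    · cases c <;> first | rfl | exact e7 _
    · refine Fin.cases ?_ (fun k => e7 _) k
      cases c <;> first | rfl | exact e7 _

/-- If the two arcs of a state are horizontal, the lower one is closed to a circle. -/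
theorem StateShape.addBelow_true_of_false {T : TangleDiagram} {s : Fin T.n → Bool} {k : ℕ}
    (h : T.StateShape s false k) : T.addBelow.StateShape (Fin.cons true s) false (k + 1) := by
  obtain ⟨f, hr, hs, hu, h1, h2, h3, h4⟩ := h
  set ψ : Fin k ⊕ Bool → Fin (k + 1) ⊕ Bool :=
    Sum.elim (fun i => Sum.inl i.succ) (fun b => if b then Sum.inr true else Sum.inl 0) with hψ
  refine ⟨extendBelow (fun P => ψ (f P)) (Sum.inr false) (Sum.inr false), ?_, ?_, ?_,
    by simp [extendBelow, h1, hψ], rfl, by simp [extendBelow, h3, hψ], rfl⟩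
  · refine (respects_addBelow_iff T _ s _).2 ?_
    simp only [extendBelow_shiftBelow]
    exact ⟨hr.comp ψ, ⟨rfl, rfl⟩, by simp [extendBelow, h4, h2], rfl⟩
  · rintro (q | _ | _)
    · refine Fin.cases ⟨shiftBelow (none, .se), by simp [h2, hψ]⟩ (fun q => ?_) q
      obtain ⟨P, hP⟩ := hs (Sum.inl q)
      exact ⟨shiftBelow P, by simp [hP, hψ]⟩
    · exact ⟨(none, .sw), rfl⟩
    · exact ⟨(none, .nw), by simp [extendBelow, h1, hψ]⟩
  · intro X (g : TPoint (T.n + 1) → X) hg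
    obtain ⟨hg, ⟨e1, e2⟩, e3, e4⟩ := (respects_addBelow_iff T _ s g).1 hg
    obtain ⟨φ, hφ⟩ := hu X _ hg
    have e6 : g (none, .se) = g (none, .sw) := e2.symm.trans (e4.symm.trans e1)
    set χ : Fin (k + 1) ⊕ Bool → X := Sum.elim (Fin.cons (φ (Sum.inr false)) fun i => φ (Sum.inl i))
        (fun b => if b then φ (Sum.inr true) else g (none, .sw)) with hχ
    have e7 : ∀ q, φ q = χ (ψ q) := by
      rintro (q | _ | _) <;> simp [hψ, hχ]
    refine ⟨χ, fun (P : TPoint (T.n + 1)) => ?_⟩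
    rw [eq_extendBelow g e1 e2 P, e6]
    simp only [hφ]
    rcases P with ⟨_ | k, c⟩
    · cases c <;> first | rfl | exact e7 _
    · refine Fin.cases ?_ (fun k => e7 _) k
      cases c <;> first | rfl | exact e7 _

/-- A map with the universal property of a quotient has as many values as the quotient. -/
theorem card_quot_eq {P Q : Type} (r : P → P → Prop) (f : P → Q) (hr : ∀ x y, r x y → f x = f y)
    (hs : Function.Surjective f)
    (hu : ∀ (X : Type) (g : P → X), (∀ x y, r x y → g x = g y) → ∃ h : Q → X, ∀ x, g x = h (f x)) :
    Nat.card (Quot r) = Nat.card Q := by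
  refine Nat.card_congr (Equiv.ofBijective (Quot.lift f hr) ⟨?_, fun q => ?_⟩)
  · obtain ⟨h, hh⟩ := hu _ (Quot.mk r) fun x y => Quot.sound
    rintro ⟨x⟩ ⟨y⟩ hxy
    rw [hh, hh]
    exact congrArg h hxy
  · obtain ⟨x, rfl⟩ := hs q
    exact ⟨Quot.mk r x, rfl⟩

theorem stateArc_iff (T : TangleDiagram) (s : Fin T.n → Bool) {X : Type} (g : TPoint T.n → X) :
    (∀ P Q, T.StateArc s P Q → g P = g Q) ↔ T.Respects s g ∧ g (none, .nw) = g (none, .sw) ∧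
      g (none, .ne) = g (none, .se) := by
  constructor
  · intro h
    exact ⟨⟨fun a ha => h _ _ (.inl ha), fun k a ha => h _ _ (.inr (.inr ⟨k, ha⟩))⟩,
      h _ _ (.inr (.inl (by simp [closingArcs]))), h _ _ (.inr (.inl (by simp [closingArcs])))⟩
  · rintro ⟨⟨h1, h2⟩, h3, h4⟩ P Q (h | h | ⟨k, h⟩)
    · exact h1 _ h
    · simp only [closingArcs, List.mem_cons, Prod.mk.injEq, List.not_mem_nil, or_false] at h
      rcases h with ⟨rfl, rfl⟩ | ⟨rfl, rfl⟩
      exacts [h3, h4]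
    · exact h2 k _ h

/-- The closing arcs join the two arcs of a state to one circle if they are horizontal, and to two
circles if they are vertical. -/
theorem StateShape.circles_eq {T : TangleDiagram} {s : Fin T.n → Bool} {v : Bool} {k : ℕ}
    (h : T.StateShape s v k) : T.circles s = k + 1 + v.toNat := by
  obtain ⟨f, hr, hs, hu, h1, h2, h3, h4⟩ := h
  cases v with
  | true =>
    refine (card_quot_eq _ f ((stateArc_iff T s f).2 ⟨hr, h1.trans h4.symm, h3.trans h2.symm⟩) hs
      fun X g hg => hu X g ((stateArc_iff T s g).1 hg).1).trans ?_
    simp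
  | false =>
    set ψ : Fin k ⊕ Bool → Fin k ⊕ Unit := Sum.map id (fun _ => ()) with hψ
    refine (card_quot_eq _ (fun P => ψ (f P)) ((stateArc_iff T s _).2 ⟨hr.comp ψ, ?_, ?_⟩) ?_
      fun X g hg => ?_).trans ?_
    · simp [h1, h4, hψ]
    · simp [h3, h2, hψ]
    · rintro (q | _)
      · obtain ⟨P, hP⟩ := hs (Sum.inl q)
        exact ⟨P, by simp [hP, hψ]⟩
      · exact ⟨(none, .nw), by simp [h1, hψ]⟩
    · obtain ⟨hg, e1, -⟩ := (stateArc_iff T s g).1 hg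
      obtain ⟨φ, hφ⟩ := hu X g hg
      rw [hφ, hφ, h1, h4] at e1
      refine ⟨Sum.elim (fun i => φ (Sum.inl i)) (fun _ => φ (Sum.inr true)), fun P => ?_⟩
      rw [hφ]
      rcases f P with q | _ | _ <;> simp [hψ, e1]
    · simp

end TangleDiagram

/-! ### The bracket of a tangle diagram as a linear combination of the tangles `0` and `∞` -/

namespace TangleDiagram

open LaurentPolynomial (T)

/-- The value `-A² - A⁻²` of a circle. -/
noncomputable def circleValue : LaurentPolynomial ℤ := -T 2 - T (-2)

/-- The product `A ^ (a(s) - b(s))` over the smoothings of a state. -/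
noncomputable def stateWeight {n : ℕ} (s : Fin n → Bool) : LaurentPolynomial ℤ :=
  T (∑ k, if s k = true then (1 : ℤ) else -1)

/-- The part of the state sum from the states with horizontal arcs (`v s = false`), if the state `s`
has `k s` circles. -/
noncomputable def horizontalCoeff {n : ℕ} (v : (Fin n → Bool) → Bool) (k : (Fin n → Bool) → ℕ) :
    LaurentPolynomial ℤ :=
  ∑ s, if v s then 0 else stateWeight s * circleValue ^ k s

/-- The part of the state sum from the states with vertical arcs (`v s = true`), if the state `s`
has `k s` circles. -/
noncomputable def verticalCoeff {n : ℕ} (v : (Fin n → Bool) → Bool) (k : (Fin n → Bool) → ℕ) :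
    LaurentPolynomial ℤ :=
  ∑ s, if v s then stateWeight s * circleValue ^ k s else 0

/-- The Kauffman bracket of the tangle diagram `D` is `a⟨0⟩ + b⟨∞⟩`: the coefficients `a` and `b`
collect the states in which the two arcs are horizontal, respectively vertical. -/
def HasCoords (D : TangleDiagram) (a b : LaurentPolynomial ℤ) : Prop :=
  ∃ (v : (Fin D.n → Bool) → Bool) (k : (Fin D.n → Bool) → ℕ),
    (∀ s, D.StateShape s (v s) (k s)) ∧
    a = horizontalCoeff v k ∧ b = verticalCoeff v k

theorem stateWeight_cons {n : ℕ} (b : Bool) (s : Fin n → Bool) :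
    stateWeight (Fin.cons b s : Fin (n + 1) → Bool) = T (if b then 1 else -1) * stateWeight s := by
  rw [stateWeight, Fin.sum_univ_succ, LaurentPolynomial.T_add]
  rfl

theorem sum_fin_succ_bool {n : ℕ} {M : Type*} [AddCommMonoid M] (F : (Fin (n + 1) → Bool) → M) :
    ∑ s, F s = ∑ s : Fin n → Bool, (F (Fin.cons true s) + F (Fin.cons false s)) := by
  rw [← (Fin.consEquiv fun _ => Bool).sum_comp, Fintype.sum_prod_type, Fintype.sum_bool,
    Finset.sum_add_distrib]
  rfl

theorem hasCoords_zero : zero.HasCoords 1 0 :=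
  ⟨fun _ => false, fun _ => 0, fun s => stateShape_zero s, by
    have : Unique (Fin zero.n → Bool) := inferInstanceAs (Unique (Fin 0 → Bool))
    have h : ∀ s : Fin zero.n → Bool, stateWeight s = 1 := fun s => LaurentPolynomial.T_zero
    simp [horizontalCoeff, h], by simp [verticalCoeff]⟩

theorem hasCoords_infinity : infinity.HasCoords 0 1 :=
  ⟨fun _ => true, fun _ => 0, fun s => stateShape_infinity s,
    by simp [horizontalCoeff], by
    have : Unique (Fin infinity.n → Bool) := inferInstanceAs (Unique (Fin 0 → Bool))
    have h : ∀ s : Fin infinity.n → Bool, stateWeight s = 1 := fun s => LaurentPolynomial.T_zero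
    simp [verticalCoeff, h]⟩

theorem T_one_add_circleValue : T 1 + T (-1) * circleValue = -T (-3) := by
  rw [circleValue, mul_sub, mul_neg, ← LaurentPolynomial.T_add, ← LaurentPolynomial.T_add]
  norm_num
  ring

theorem T_neg_one_add_circleValue : T (-1) + T 1 * circleValue = -T 3 := by
  rw [circleValue, mul_sub, mul_neg, ← LaurentPolynomial.T_add, ← LaurentPolynomial.T_add]
  norm_num

/-- The effect of a crossing on the right on the shape of a state: the `A`-smoothing keeps it, the
`B`-smoothing makes it vertical. -/
def rightShape {n : ℕ} (v : (Fin n → Bool) → Bool) (t : Fin (n + 1) → Bool) : Bool :=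
  if t 0 then v (Fin.tail t) else true

/-- The effect of a crossing on the right on the number of circles of a state. -/
def rightCircles {n : ℕ} (v : (Fin n → Bool) → Bool) (k : (Fin n → Bool) → ℕ)
    (t : Fin (n + 1) → Bool) : ℕ :=
  if t 0 then k (Fin.tail t) else k (Fin.tail t) + (v (Fin.tail t)).toNat

/-- The effect of a crossing below on the shape of a state: the `A`-smoothing makes it horizontal,
the `B`-smoothing keeps it. -/
def belowShape {n : ℕ} (v : (Fin n → Bool) → Bool) (t : Fin (n + 1) → Bool) : Bool :=
  if t 0 then false else v (Fin.tail t)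

/-- The effect of a crossing below on the number of circles of a state. -/
def belowCircles {n : ℕ} (v : (Fin n → Bool) → Bool) (k : (Fin n → Bool) → ℕ)
    (t : Fin (n + 1) → Bool) : ℕ :=
  if t 0 then k (Fin.tail t) + (!v (Fin.tail t)).toNat else k (Fin.tail t)

section Coefficients

variable {n : ℕ} (v : (Fin n → Bool) → Bool) (k : (Fin n → Bool) → ℕ)

theorem horizontalCoeff_right :
    horizontalCoeff (rightShape v) (rightCircles v k) = T 1 * horizontalCoeff v k := by
  rw [horizontalCoeff, sum_fin_succ_bool, horizontalCoeff, Finset.mul_sum]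
  refine Finset.sum_congr rfl fun s _ => ?_
  simp only [rightShape, rightCircles, Fin.cons_zero, Fin.tail_cons, stateWeight_cons]
  cases v s <;> simp [mul_assoc]

theorem verticalCoeff_right :
    verticalCoeff (rightShape v) (rightCircles v k) =
      T (-1) * horizontalCoeff v k - T (-3) * verticalCoeff v k := by
  rw [verticalCoeff, sum_fin_succ_bool, horizontalCoeff, verticalCoeff, Finset.mul_sum,
    Finset.mul_sum, ← Finset.sum_sub_distrib]
  refine Finset.sum_congr rfl fun s _ => ?_
  simp only [rightShape, rightCircles, Fin.cons_zero, Fin.tail_cons, stateWeight_cons]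
  cases v s
  · simp [mul_assoc]
  · simp only [if_true, Bool.toNat_true, pow_succ, Bool.false_eq_true, if_false]
    linear_combination (stateWeight s * circleValue ^ k s) * T_one_add_circleValue

theorem horizontalCoeff_below :
    horizontalCoeff (belowShape v) (belowCircles v k) =
      T 1 * verticalCoeff v k - T 3 * horizontalCoeff v k := by
  rw [horizontalCoeff, sum_fin_succ_bool, horizontalCoeff, verticalCoeff, Finset.mul_sum,
    Finset.mul_sum, ← Finset.sum_sub_distrib]
  refine Finset.sum_congr rfl fun s _ => ?_
  simp only [belowShape, belowCircles, Fin.cons_zero, Fin.tail_cons, stateWeight_cons]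
  cases v s
  · simp only [if_true, Bool.not_false, Bool.toNat_true, pow_succ, Bool.false_eq_true, if_false]
    linear_combination (stateWeight s * circleValue ^ k s) * T_neg_one_add_circleValue
  · simp [mul_assoc]

theorem verticalCoeff_below :
    verticalCoeff (belowShape v) (belowCircles v k) = T (-1) * verticalCoeff v k := by
  rw [verticalCoeff, sum_fin_succ_bool, verticalCoeff, Finset.mul_sum]
  refine Finset.sum_congr rfl fun s _ => ?_
  simp only [belowShape, belowCircles, Fin.cons_zero, Fin.tail_cons, stateWeight_cons]
  cases v s <;> simp [mul_assoc]

end Coefficients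

theorem HasCoords.addRight {D : TangleDiagram} {a b : LaurentPolynomial ℤ} (h : D.HasCoords a b) :
    D.addRight.HasCoords (T 1 * a) (T (-1) * a - T (-3) * b) := by
  obtain ⟨v, k, hs, rfl, rfl⟩ := h
  refine ⟨rightShape v, rightCircles v k, fun (t : Fin (D.n + 1) → Bool) => ?_,
    (horizontalCoeff_right v k).symm, (verticalCoeff_right v k).symm⟩
  obtain ⟨b, s, rfl⟩ : ∃ b s, t = Fin.cons b s := ⟨t 0, Fin.tail t, (Fin.cons_self_tail t).symm⟩
  simp only [rightShape, rightCircles, Fin.cons_zero, Fin.tail_cons]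
  have h := hs s
  cases b
  · cases hv : v s <;> rw [hv] at h
    exacts [h.addRight_false, h.addRight_false_of_true]
  · exact h.addRight_true

theorem HasCoords.addBelow {D : TangleDiagram} {a b : LaurentPolynomial ℤ} (h : D.HasCoords a b) :
    D.addBelow.HasCoords (T 1 * b - T 3 * a) (T (-1) * b) := by
  obtain ⟨v, k, hs, rfl, rfl⟩ := h
  refine ⟨belowShape v, belowCircles v k, fun (t : Fin (D.n + 1) → Bool) => ?_,
    (horizontalCoeff_below v k).symm, (verticalCoeff_below v k).symm⟩
  obtain ⟨b, s, rfl⟩ : ∃ b s, t = Fin.cons b s := ⟨t 0, Fin.tail t, (Fin.cons_self_tail t).symm⟩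
  simp only [belowShape, belowCircles, Fin.cons_zero, Fin.tail_cons]
  have h := hs s
  cases b
  · exact h.addBelow_false
  · cases hv : v s <;> rw [hv] at h
    exacts [h.addBelow_true_of_false, h.addBelow_true]

theorem HasCoords.bracket_eq {D : TangleDiagram} {a b : LaurentPolynomial ℤ}
    (h : D.HasCoords a b) : D.bracket = a + circleValue * b := by
  obtain ⟨v, k, hs, rfl, rfl⟩ := h
  rw [bracket, horizontalCoeff, verticalCoeff, Finset.mul_sum, ← Finset.sum_add_distrib]
  refine Finset.sum_congr rfl fun s _ => ?_
  rw [(hs s).circles_eq]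
  change stateWeight s * circleValue ^ (k s + 1 + (v s).toNat - 1) = _
  cases v s
  · simp
  · simp [pow_succ]
    ring

/-! ### Rational tangle diagrams as words in the two kinds of twists -/

/-- `IsTwisted w D` says that the tangle diagram `D` arises from a single crossing by adding further
crossings, the last ones first in the word `w`: one below for each letter `true`, and one on the
right for each letter `false`. The single crossing can be obtained from the tangle `0` or from the
tangle `∞`, with the same bracket and fraction. -/
inductive IsTwisted : List Bool → TangleDiagram → Prop
  | right_zero : IsTwisted [] zero.addRight
  | below_infinity : IsTwisted [] infinity.addBelow
  | addBelow {w : List Bool} {D : TangleDiagram} : IsTwisted w D → IsTwisted (true :: w) D.addBelow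
  | addRight {w : List Bool} {D : TangleDiagram} : IsTwisted w D → IsTwisted (false :: w) D.addRight

/-- The coefficients of `⟨0⟩` and `⟨∞⟩` in the bracket of the tangle of a word. -/
noncomputable def coords : List Bool → LaurentPolynomial ℤ × LaurentPolynomial ℤ
  | [] => (T 1, T (-1))
  | true :: w => (T 1 * (coords w).2 - T 3 * (coords w).1, T (-1) * (coords w).2)
  | false :: w => (T 1 * (coords w).1, T (-1) * (coords w).1 - T (-3) * (coords w).2)

theorem IsTwisted.hasCoords {w : List Bool} {D : TangleDiagram} (h : IsTwisted w D) :
    D.HasCoords (coords w).1 (coords w).2 := by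
  induction h with
  | right_zero => simpa [coords] using hasCoords_zero.addRight
  | below_infinity => simpa [coords] using hasCoords_infinity.addBelow
  | addBelow _ ih => exact ih.addBelow
  | addRight _ ih => exact ih.addRight

/-- The fraction `p/q` of the tangle of a word, as the pair `(p, q)`. -/
def frac : List Bool → ℕ × ℕ
  | [] => (1, 1)
  | true :: w => ((frac w).1, (frac w).1 + (frac w).2)
  | false :: w => ((frac w).1 + (frac w).2, (frac w).2)

/-- The number of crossings on the right minus the number of those below, in a word. -/
def excess : List Bool → ℤ
  | [] => 0
  | true :: w => excess w - 1
  | false :: w => excess w + 1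

theorem frac_pos (w : List Bool) : 0 < (frac w).1 ∧ 0 < (frac w).2 := by
  induction w with
  | nil => simp [frac]
  | cons b w ih => cases b <;> simp only [frac] <;> omega

theorem frac_coprime (w : List Bool) : Nat.Coprime (frac w).1 (frac w).2 := by
  induction w with
  | nil => simp [frac]
  | cons b w ih => cases b <;> simpa [frac] using ih

/-- The Euclidean algorithm recovers a word from its fraction. -/
theorem frac_injective : Function.Injective frac := by
  intro w
  induction w with
  | nil =>
    rintro (_ | ⟨_ | _, w⟩) h
    · rfl
    all_goals
      have := frac_pos w
      simp only [frac, Prod.mk.injEq] at h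
      omega
  | cons b w ih =>
    rintro (_ | ⟨b', w'⟩) h
    · have := frac_pos w
      cases b <;> simp only [frac, Prod.mk.injEq] at h <;> omega
    · have h1 := frac_pos w
      have h2 := frac_pos w'
      have h3 : b = b' ∧ frac w = frac w' := by
        cases b <;> cases b' <;> simp only [frac, Prod.mk.injEq] at h <;>
          first | omega | exact ⟨rfl, Prod.ext (by omega) (by omega)⟩
      rw [h3.1, ih h3.2]

theorem IsTwisted.addBelow_iterate {w : List Bool} {D : TangleDiagram} (h : IsTwisted w D) (n : ℕ) :
    IsTwisted (List.replicate n true ++ w) (TangleDiagram.addBelow^[n] D) := by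
  induction n with
  | zero => exact h
  | succ n ih =>
    rw [Function.iterate_succ_apply']
    exact ih.addBelow

theorem IsTwisted.addRight_iterate {w : List Bool} {D : TangleDiagram} (h : IsTwisted w D) (n : ℕ) :
    IsTwisted (List.replicate n false ++ w) (TangleDiagram.addRight^[n] D) := by
  induction n with
  | zero => exact h
  | succ n ih =>
    rw [Function.iterate_succ_apply']
    exact ih.addRight

theorem frac_replicate_true_append (n : ℕ) (w : List Bool) :
    frac (List.replicate n true ++ w) = ((frac w).1, n * (frac w).1 + (frac w).2) := by
  induction n with
  | zero => simp
  | succ n ih =>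
    rw [List.replicate_succ, List.cons_append, frac, ih]
    ext
    · rfl
    · simp only
      ring

theorem frac_replicate_false_append (n : ℕ) (w : List Bool) :
    frac (List.replicate n false ++ w) = (n * (frac w).2 + (frac w).1, (frac w).2) := by
  induction n with
  | zero => simp
  | succ n ih =>
    rw [List.replicate_succ, List.cons_append, frac, ih]
    ext
    · simp only
      ring
    · rfl

theorem excess_append (w w' : List Bool) : excess (w ++ w') = excess w + excess w' := by
  induction w with
  | nil => simp [excess]
  | cons b w ih => cases b <;> simp only [List.cons_append, excess, ih] <;> ring

theorem excess_replicate_true (n : ℕ) : excess (List.replicate n true) = -n := by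
  induction n with
  | zero => simp [excess]
  | succ n ih => simp [List.replicate_succ, excess, ih]; ring

theorem excess_replicate_false (n : ℕ) : excess (List.replicate n false) = n := by
  induction n with
  | zero => simp [excess]
  | succ n ih => simp [List.replicate_succ, excess, ih]

/-- The alternating sum `-a₁ + a₂ - ⋯ + (-1)ⁿ aₙ`. -/
def altSum : List ℕ → ℤ
  | [] => 0
  | a :: l => -a - altSum l

theorem altSum_eq (l : List ℕ) :
    ∑ j : Fin l.length, (-1) ^ ((j : ℕ) + 1) * (l.get j : ℤ) = altSum l := by
  induction l with
  | nil => simp [altSum]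
  | cons a l ih =>
    rw [altSum, ← ih]
    refine (Fin.sum_univ_succ _).trans ?_
    simp only [Fin.val_zero, Fin.val_succ, pow_succ, List.get_eq_getElem, List.getElem_cons_zero,
      List.getElem_cons_succ]
    simp [sub_eq_add_neg]

/-- The standard diagrams of a nonempty continued fraction are twisted tangles. The correction in
the weight is the contribution of the first crossing, which is a vertical or a horizontal twist
according to the parity of the length. -/
theorem exists_isTwisted_build (l : List ℕ) (hl : ∀ a ∈ l, 0 < a) (h0 : l ≠ []) :
    (∃ w, IsTwisted w (build true l) ∧ cfValue l = ((frac w).1 : ℚ) / (frac w).2 ∧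
      excess w = altSum l + if Odd l.length then 1 else -1) ∧
    ∃ w, IsTwisted w (build false l) ∧ cfValue l = ((frac w).2 : ℚ) / (frac w).1 ∧
      excess w = -altSum l - if Odd l.length then 1 else -1 := by
  induction l with
  | nil => exact absurd rfl h0
  | cons a l ih =>
    obtain ⟨ha, hl⟩ := List.forall_mem_cons.1 hl
    cases l with
    | nil =>
      obtain ⟨n, rfl⟩ : ∃ n, a = n + 1 := ⟨a - 1, by omega⟩
      refine ⟨⟨_, IsTwisted.below_infinity.addBelow_iterate n, ?_, ?_⟩,
        ⟨_, IsTwisted.right_zero.addRight_iterate n, ?_, ?_⟩⟩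
      · rw [frac_replicate_true_append]
        simp [cfValue, frac]
      · simp [excess_replicate_true, altSum]
      · rw [frac_replicate_false_append]
        simp [cfValue, frac]
      · simp [excess_replicate_false, altSum]
    | cons a' l =>
      obtain ⟨⟨w, hw, hv, he⟩, w', hw', hv', he'⟩ := ih hl (by simp)
      have hodd : Odd (a :: a' :: l).length ↔ ¬ Odd (a' :: l).length := by
        rw [List.length_cons (as := a' :: l), Nat.odd_add_one]
      refine ⟨⟨_, hw'.addBelow_iterate a, ?_, ?_⟩, _, hw.addRight_iterate a, ?_, ?_⟩
      · have := frac_pos w'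
        have h1 : ((frac w').1 : ℚ) ≠ 0 := by exact_mod_cast this.1.ne'
        have h2 : (a * (frac w').1 + (frac w').2 : ℚ) ≠ 0 := by
          exact_mod_cast (by omega : a * (frac w').1 + (frac w').2 ≠ 0)
        rw [cfValue, hv', frac_replicate_true_append]
        push_cast
        field_simp
      · rw [excess_append, excess_replicate_true, he',
          show altSum (a :: a' :: l) = -a - altSum (a' :: l) from rfl]
        by_cases h : Odd (a' :: l).length
        · rw [if_pos h, if_neg (fun h' => hodd.1 h' h)]
          ring
        · rw [if_neg h, if_pos (hodd.2 h)]
          ring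
      · have := frac_pos w
        have h1 : ((frac w).2 : ℚ) ≠ 0 := by exact_mod_cast this.2.ne'
        have h2 : (a * (frac w).2 + (frac w).1 : ℚ) ≠ 0 := by
          exact_mod_cast (by omega : a * (frac w).2 + (frac w).1 ≠ 0)
        rw [cfValue, hv, frac_replicate_false_append]
        push_cast
        field_simp
      · rw [excess_append, excess_replicate_false, he,
          show altSum (a :: a' :: l) = -a - altSum (a' :: l) from rfl]
        by_cases h : Odd (a' :: l).length
        · rw [if_pos h, if_neg (fun h' => hodd.1 h' h)]
          ring
        · rw [if_neg h, if_pos (hodd.2 h)]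
          ring

end TangleDiagram

/-! ### The normalised bracket of a word and its symmetries -/

theorem negACubed_add (j k : ℤ) : negACubed (j + k) = negACubed j * negACubed k := by
  simp only [negACubed, Int.negOnePow_add, mul_add, LaurentPolynomial.T_add, Units.val_mul, map_mul]
  ring

theorem negACubed_one : negACubed 1 = -LaurentPolynomial.T 3 := by
  simp [negACubed]

theorem negACubed_neg_one : negACubed (-1) = -LaurentPolynomial.T (-3) := by
  simp [negACubed]

theorem invert_negACubed (k : ℤ) : LaurentPolynomial.invert (negACubed k) = negACubed (-k) := by
  simp [negACubed, Int.negOnePow_neg]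

section Matrices

variable {R : Type*} [CommRing R]

/-- The product of the matrices by which the letters of a word act on the normalised coordinates of
a tangle, with a unit `u` and its inverse `u'`. For `u = 1` these are generators of the modular
group. -/
def wordMatrix (u u' : R) : List Bool → Matrix (Fin 2) (Fin 2) R
  | [] => 1
  | true :: w => !![1, 1; 0, u'] * wordMatrix u u' w
  | false :: w => !![u, 0; 1, 1] * wordMatrix u u' w

theorem wordMatrix_append (u u' : R) (w w' : List Bool) :
    wordMatrix u u' (w ++ w') = wordMatrix u u' w * wordMatrix u u' w' := by
  induction w with
  | nil => simp [wordMatrix]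
  | cons b w ih => cases b <;> simp [wordMatrix, ih]

/-- Both generators are self-adjoint for one symmetric bilinear form, hence the adjoint of the
matrix of a word is the matrix of the reversed word. -/
theorem form_mul_wordMatrix {u u' : R} (hu : u * u' = 1) (w : List Bool) :
    !![u - 1, u; u, u - u ^ 2] * wordMatrix u u' w =
      (wordMatrix u u' w.reverse).transpose * !![u - 1, u; u, u - u ^ 2] := by
  induction w with
  | nil => simp [wordMatrix]
  | cons b w ih =>
    have h : ∀ b, !![u - 1, u; u, u - u ^ 2] * wordMatrix u u' [b] =
        (wordMatrix u u' [b]).transpose * !![u - 1, u; u, u - u ^ 2] := by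
      rintro (_ | _)
      · ext i j
        fin_cases i <;> fin_cases j <;>
          simp [wordMatrix, Matrix.mul_apply, Fin.sum_univ_two] <;> ring
      · ext i j
        fin_cases i <;> fin_cases j <;> simp [wordMatrix, Matrix.mul_apply, Fin.sum_univ_two]
        · linear_combination hu
        · linear_combination (-1 : R) * hu
        · ring
    rw [List.reverse_cons, wordMatrix_append, Matrix.transpose_mul, mul_assoc, ← ih, ← mul_assoc,
      ← h, mul_assoc, ← wordMatrix_append, List.singleton_append]

/-- For `u = -A⁴` and its inverse `u'`, this is the invariance of the bracket of the frieze under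
the reversal of the word, see `friezePolynomial`. -/
theorem dotProduct_wordMatrix_reverse {u u' : R} (hu : u * u' = 1) (w : List Bool) :
    ![1, u'] ⬝ᵥ (wordMatrix u u' w.reverse).mulVec ![u, 1] =
      ![1, u'] ⬝ᵥ (wordMatrix u u' w).mulVec ![u, 1] := by
  have h := form_mul_wordMatrix hu w
  generalize wordMatrix u u' w = M at h ⊢
  generalize wordMatrix u u' w.reverse = N at h ⊢
  have h00 := congrFun (congrFun h 0) 0
  have h01 := congrFun (congrFun h 0) 1
  have h10 := congrFun (congrFun h 1) 0
  have h11 := congrFun (congrFun h 1) 1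
  simp [Matrix.mul_apply, Fin.sum_univ_two] at h00 h01 h10 h11
  -- The row `(1, u')` is `u⁻²` times the product of the vector `(u, 1)` and the form, so both sides
  -- are values of the quadratic forms of transposed matrices at `(u, 1)`.
  have key : u ^ 2 * (![1, u'] ⬝ᵥ N.mulVec ![u, 1]) = u ^ 2 * (![1, u'] ⬝ᵥ M.mulVec ![u, 1]) := by
    simp [Matrix.mulVec, dotProduct, Fin.sum_univ_two]
    linear_combination (-u ^ 2) * h00 - u * h01 - u * h10 - h11 +
      (u * (u * N 1 0 + N 1 1) - u * (u * M 1 0 + M 1 1)) * hu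
  have hu2 : u' ^ 2 * u ^ 2 = 1 := by rw [← mul_pow, mul_comm, hu, one_pow]
  calc _ = u' ^ 2 * u ^ 2 * (![1, u'] ⬝ᵥ N.mulVec ![u, 1]) := by rw [hu2, one_mul]
    _ = u' ^ 2 * u ^ 2 * (![1, u'] ⬝ᵥ M.mulVec ![u, 1]) := by rw [mul_assoc, key, ← mul_assoc]
    _ = _ := by rw [hu2, one_mul]

end Matrices

namespace TangleDiagram

open LaurentPolynomial (T)

/-- The coordinates of the tangle of a word, normalised by a power of `-A³` and with the second one
divided by `-A²`, so that they only depend on `u = -A⁴`. -/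
noncomputable def normCoords (w : List Bool) : Fin 2 → LaurentPolynomial ℤ :=
  (wordMatrix (-T 4) (-T (-4)) w).mulVec ![-T 4, 1]

theorem normCoords_nil : normCoords [] = ![-T 4, 1] := by
  simp [normCoords, wordMatrix]

theorem normCoords_true (w : List Bool) :
    normCoords (true :: w) = ![normCoords w 0 + normCoords w 1, -T (-4) * normCoords w 1] := by
  rw [normCoords, wordMatrix, ← Matrix.mulVec_mulVec, ← normCoords]
  ext i
  fin_cases i <;> simp [Matrix.mulVec, dotProduct, Fin.sum_univ_two]

theorem normCoords_false (w : List Bool) :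
    normCoords (false :: w) = ![-T 4 * normCoords w 0, normCoords w 0 + normCoords w 1] := by
  rw [normCoords, wordMatrix, ← Matrix.mulVec_mulVec, ← normCoords]
  ext i
  fin_cases i <;> simp [Matrix.mulVec, dotProduct, Fin.sum_univ_two]

theorem normCoords_eq (w : List Bool) :
    negACubed (excess w + 1) * (coords w).1 = normCoords w 0 ∧
      negACubed (excess w + 1) * (coords w).2 = -T 2 * normCoords w 1 := by
  induction w with
  | nil =>
    simp only [excess, coords, zero_add, negACubed_one, normCoords_nil, neg_mul,
      ← LaurentPolynomial.T_add]
    norm_num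
  | cons b w ih =>
    obtain ⟨h1, h2⟩ := ih
    cases b
    · have e : excess (false :: w) + 1 = excess w + 1 + 1 := rfl
      rw [e, negACubed_add, negACubed_one, coords, normCoords_false]
      have t1 : (T 3 * T 1 : LaurentPolynomial ℤ) = T 4 := by
        rw [← LaurentPolynomial.T_add]; norm_num
      have t2 : (T 3 * T (-1) : LaurentPolynomial ℤ) = T 2 := by
        rw [← LaurentPolynomial.T_add]; norm_num
      have t3 : (T 3 * T (-3) : LaurentPolynomial ℤ) = 1 := by
        rw [← LaurentPolynomial.T_add]; norm_num
      constructor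
      · simp only [Matrix.cons_val_zero]
        linear_combination (-T 4) * h1 - negACubed (excess w + 1) * (coords w).1 * t1
      · simp only [Matrix.cons_val_one, Matrix.cons_val_zero]
        linear_combination (-T 2) * h1 + h2 - negACubed (excess w + 1) * (coords w).1 * t2 +
          negACubed (excess w + 1) * (coords w).2 * t3
    · have e : excess (true :: w) + 1 = excess w + 1 + -1 := by rw [excess]; ring
      rw [e, negACubed_add, negACubed_neg_one, coords, normCoords_true]
      have t1 : (T (-3) * T 3 : LaurentPolynomial ℤ) = 1 := by
        rw [← LaurentPolynomial.T_add]; norm_num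
      have t2 : (T (-3) * T (-1) : LaurentPolynomial ℤ) = T (-4) := by
        rw [← LaurentPolynomial.T_add]; norm_num
      have t3 : (T (-3) * T 1 * T 2 : LaurentPolynomial ℤ) = 1 := by
        rw [← LaurentPolynomial.T_add, ← LaurentPolynomial.T_add]; norm_num
      constructor
      · simp only [Matrix.cons_val_zero]
        linear_combination h1 - (T (-3) * T 1) * h2 + negACubed (excess w + 1) * (coords w).1 * t1 +
          normCoords w 1 * t3
      · simp only [Matrix.cons_val_one, Matrix.cons_val_zero]
        linear_combination (-T (-4)) * h2 - negACubed (excess w + 1) * (coords w).2 * t2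

/-- The Kauffman bracket of the frieze of the fraction whose tangle is that of the word
`true :: w`. -/
noncomputable def friezePolynomial (w : List Bool) : LaurentPolynomial ℤ :=
  normCoords w 0 - T (-4) * normCoords w 1

theorem negACubed_mul_bracket {w : List Bool} {D : TangleDiagram} (h : IsTwisted (true :: w) D) :
    negACubed (excess w) * D.bracket = friezePolynomial w := by
  have e : excess w = excess (true :: w) + 1 := by rw [excess]; ring
  obtain ⟨h1, h2⟩ := normCoords_eq (true :: w)
  rw [h.hasCoords.bracket_eq, e, mul_add, h1, mul_left_comm, h2, normCoords_true, friezePolynomial,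
    circleValue]
  simp only [Matrix.cons_val_one, Matrix.cons_val_zero]
  have t1 : (T 2 * T 2 * T (-4) : LaurentPolynomial ℤ) = 1 := by
    rw [← LaurentPolynomial.T_add, ← LaurentPolynomial.T_add]; norm_num
  have t2 : (T (-2) * T 2 : LaurentPolynomial ℤ) = 1 := by
    rw [← LaurentPolynomial.T_add]; norm_num
  linear_combination (-normCoords w 1) * t1 - T (-4) * normCoords w 1 * t2

theorem T_four_mul_T_neg_four : (-T 4 * -T (-4) : LaurentPolynomial ℤ) = 1 := by
  rw [neg_mul_neg, ← LaurentPolynomial.T_add]; norm_num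

theorem friezePolynomial_reverse (w : List Bool) :
    friezePolynomial w.reverse = friezePolynomial w := by
  have h := dotProduct_wordMatrix_reverse T_four_mul_T_neg_four w
  rw [← normCoords, ← normCoords] at h
  simpa [friezePolynomial, dotProduct, Fin.sum_univ_two, sub_eq_add_neg] using h

/-- Interchanging the two kinds of twists replaces `u` by `u⁻¹` and interchanges the coordinates. -/
theorem invert_normCoords (w : List Bool) :
    LaurentPolynomial.invert (normCoords w 0) = -T (-4) * normCoords (w.map not) 1 ∧
      LaurentPolynomial.invert (normCoords w 1) = -T (-4) * normCoords (w.map not) 0 := by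
  have hT := T_four_mul_T_neg_four
  induction w with
  | nil =>
    simp only [List.map_nil, normCoords_nil, Matrix.cons_val_zero, Matrix.cons_val_one, map_neg,
      LaurentPolynomial.invert_T, map_one]
    exact ⟨by ring, by linear_combination -hT⟩
  | cons b w ih =>
    obtain ⟨h1, h2⟩ := ih
    cases b
    · simp only [List.map_cons, Bool.not_false, normCoords_true, normCoords_false,
        Matrix.cons_val_zero, Matrix.cons_val_one, map_neg, map_add, map_mul,
        LaurentPolynomial.invert_T, h1, h2]
      refine ⟨trivial, ?_⟩
      ring
    · simp only [List.map_cons, Bool.not_true, normCoords_true, normCoords_false,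
        Matrix.cons_val_zero, Matrix.cons_val_one, map_neg, map_add, map_mul,
        LaurentPolynomial.invert_T, h1, h2, neg_neg]
      exact ⟨by ring, by ring⟩

theorem friezePolynomial_map_not (w : List Bool) :
    friezePolynomial (w.map not) = LaurentPolynomial.invert (friezePolynomial w) := by
  obtain ⟨h1, h2⟩ := invert_normCoords w
  rw [friezePolynomial, friezePolynomial, map_sub, map_mul, h1, h2, LaurentPolynomial.invert_T,
    neg_neg]
  linear_combination (-normCoords (w.map not) 0) * T_four_mul_T_neg_four

theorem excess_reverse (w : List Bool) : excess w.reverse = excess w := by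
  induction w with
  | nil => rfl
  | cons b w ih => cases b <;> simp [excess_append, excess, ih, sub_eq_add_neg]

theorem excess_map_not (w : List Bool) : excess (w.map not) = -excess w := by
  induction w with
  | nil => rfl
  | cons b w ih => cases b <;> simp [excess, ih] <;> ring

end TangleDiagram

/-! ### Orientations and the writhe of the diagram of a word -/

namespace TangleDiagram

/-- The permutation of the corners by the twist of a letter, which fixes `nw`: a crossing below
(`true`) interchanges the lower corners, a crossing on the right (`false`) the right ones. -/
def turn : Bool → Corner → Corner
  | _, .nw => .nw
  | true, .ne => .ne
  | true, .sw => .se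
  | true, .se => .sw
  | false, .sw => .sw
  | false, .ne => .se
  | false, .se => .ne

/-- The sign of the crossing of a letter, if the end points `nw` and `c` are directed alike, and the
other two end points are not. -/
def letterSign : Bool → Corner → ℤ
  | true, c => if c = .ne then -1 else 1
  | false, c => if c = .sw then 1 else -1

/-- The permutation of the corners by the twists of a word. -/
def run : List Bool → Corner → Corner
  | [], c => c
  | b :: w, c => run w (turn b c)

/-- The sum of the signs of the crossings of a word, if the end points `nw` and `c` are directed
alike. -/
def signSum : List Bool → Corner → ℤ
  | [], _ => 0
  | b :: w, c => letterSign b c + signSum w (turn b c)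

/-- The sign of a single crossing, if the end points `nw` and `c` are directed alike. The corners
`nw` and `se`, for which this is impossible, get the value `0`. -/
def endSign : Corner → ℤ
  | .sw => 1
  | .ne => -1
  | _ => 0

/-- The directions `f` of the strands at the end points are alike at `nw` and `c`, and opposite at
the other two end points. -/
def Directed (f : Corner → Bool) (c : Corner) : Prop :=
  c ≠ .nw ∧ ∀ d, f d = f .nw ↔ d = .nw ∨ d = c

theorem forall_corner {p : Corner → Prop} : (∀ c, p c) ↔ p .nw ∧ p .ne ∧ p .sw ∧ p .se :=
  ⟨fun h => ⟨h _, h _, h _, h _⟩, fun ⟨h1, h2, h3, h4⟩ c => by cases c <;> assumption⟩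

/-- An orientation of the strands of a tangle diagram, without the closing arcs. -/
structure IsOpenOrientation (D : TangleDiagram) (o : TPoint D.n → Bool) : Prop where
  arc : ∀ a ∈ D.arcs, o a.1 ≠ o a.2
  strand_nw_se : ∀ k, o (some k, .nw) ≠ o (some k, .se)
  strand_sw_ne : ∀ k, o (some k, .sw) ≠ o (some k, .ne)

section Twist

variable {D : TangleDiagram}

theorem IsOpenOrientation.of_addRight {o : TPoint (D.n + 1) → Bool}
    (h : D.addRight.IsOpenOrientation o) :
    D.IsOpenOrientation (fun P => o (shiftRight P)) ∧ o (some 0, .nw) = o (none, .se) ∧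
      o (some 0, .sw) = o (none, .ne) := by
  obtain ⟨h1, h2⟩ := List.forall_mem_cons.1 h.arc
  obtain ⟨h3, h4⟩ := List.forall_mem_cons.1 h2
  refine ⟨⟨fun a ha => h4 _ (List.mem_map_of_mem ha), fun k => h.strand_nw_se k.succ,
    fun k => h.strand_sw_ne k.succ⟩, ?_, ?_⟩
  · exact (Bool.eq_not.2 (h.strand_nw_se (0 : Fin (D.n + 1)))).trans (Bool.eq_not.2 h3.symm).symm
  · exact (Bool.eq_not.2 (h.strand_sw_ne (0 : Fin (D.n + 1)))).trans (Bool.eq_not.2 h1.symm).symm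

theorem IsOpenOrientation.of_addBelow {o : TPoint (D.n + 1) → Bool}
    (h : D.addBelow.IsOpenOrientation o) :
    D.IsOpenOrientation (fun P => o (shiftBelow P)) ∧ o (some 0, .nw) = o (none, .se) ∧
      o (some 0, .ne) = o (none, .sw) ∧ o (some 0, .sw) = !o (none, .sw) := by
  obtain ⟨h1, h2⟩ := List.forall_mem_cons.1 h.arc
  obtain ⟨h3, h4⟩ := List.forall_mem_cons.1 h2
  refine ⟨⟨fun a ha => h4 _ (List.mem_map_of_mem ha), fun k => h.strand_nw_se k.succ,
    fun k => h.strand_sw_ne k.succ⟩, ?_, ?_, Bool.eq_not.2 h1⟩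
  · exact (Bool.eq_not.2 (h.strand_nw_se (0 : Fin (D.n + 1)))).trans (Bool.eq_not.2 h3.symm).symm
  · exact (Bool.eq_not.2 (h.strand_sw_ne (0 : Fin (D.n + 1))).symm).trans
      (Bool.eq_not.2 h1.symm).symm

theorem writhe_addRight (o : TPoint (D.n + 1) → Bool) :
    D.addRight.writhe o = (if o (some 0, .nw) = o (some 0, .sw) then 1 else -1) +
      D.writhe fun P => o (shiftRight P) := by
  refine (Fin.sum_univ_succ (n := D.n) _).trans (congrArg₂ _ ?_ rfl)
  have h : D.addRight.nwOver (0 : Fin (D.n + 1)) = true := rfl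
  exact if_congr ⟨fun h' => h'.2 h, fun h' => iff_of_true h' h⟩ rfl rfl

theorem writhe_addBelow (o : TPoint (D.n + 1) → Bool) :
    D.addBelow.writhe o = (if o (some 0, .nw) = o (some 0, .sw) then 1 else -1) +
      D.writhe fun P => o (shiftBelow P) := by
  refine (Fin.sum_univ_succ (n := D.n) _).trans (congrArg₂ _ ?_ rfl)
  have h : D.addBelow.nwOver (0 : Fin (D.n + 1)) = true := rfl
  exact if_congr ⟨fun h' => h'.2 h, fun h' => iff_of_true h' h⟩ rfl rfl

theorem directed_addRight {o : TPoint (D.n + 1) → Bool} (h : D.addRight.IsOpenOrientation o)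
    {c : Corner} (hc : Directed (fun d => o (shiftRight (none, d))) c) :
    Directed (fun d => o (none, d)) (turn false c) ∧
      D.addRight.writhe o = letterSign false (turn false c) +
        D.writhe fun P => o (shiftRight P) := by
  obtain ⟨-, e1, e2⟩ := h.of_addRight
  rw [writhe_addRight, e1, e2]
  simp only [Directed, forall_corner, shiftRight, e1, e2] at hc ⊢
  clear h e1 e2
  generalize o (none, .nw) = a1 at *
  generalize o (none, .ne) = a2 at *
  generalize o (none, .sw) = a3 at *
  generalize o (none, .se) = a4 at *
  cases c <;> simp [turn, letterSign] at hc ⊢ <;> revert a1 a2 a3 a4 <;> decide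

theorem directed_addBelow {o : TPoint (D.n + 1) → Bool} (h : D.addBelow.IsOpenOrientation o)
    {c : Corner} (hc : Directed (fun d => o (shiftBelow (none, d))) c) :
    Directed (fun d => o (none, d)) (turn true c) ∧
      D.addBelow.writhe o = letterSign true (turn true c) +
        D.writhe fun P => o (shiftBelow P) := by
  obtain ⟨-, e1, e2, e3⟩ := h.of_addBelow
  rw [writhe_addBelow, e1, e3]
  simp only [Directed, forall_corner, shiftBelow, e1, e2] at hc ⊢
  clear h e1 e2 e3
  generalize o (none, .nw) = a1 at *
  generalize o (none, .ne) = a2 at *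
  generalize o (none, .sw) = a3 at *
  generalize o (none, .se) = a4 at *
  cases c <;> simp [turn, letterSign] at hc ⊢ <;> revert a1 a2 a3 a4 <;> decide

end Twist

theorem turn_turn (b : Bool) (c : Corner) : turn b (turn b c) = c := by
  cases b <;> cases c <;> rfl

theorem exists_directed_of_horizontal : ∀ f : Corner → Bool, f .nw ≠ f .ne → f .sw ≠ f .se →
    ∃ c, Directed f c ∧ (c = .sw ∨ c = .se) := by
  unfold Directed
  decide

theorem exists_directed_of_vertical : ∀ f : Corner → Bool, f .nw ≠ f .sw → f .ne ≠ f .se →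
    ∃ c, Directed f c ∧ (c = .ne ∨ c = .se) := by
  unfold Directed
  decide

theorem directed_zero {o : TPoint zero.n → Bool} (h : zero.IsOpenOrientation o) :
    ∃ c, Directed (fun d => o (none, d)) c ∧ (c = .sw ∨ c = .se) := by
  obtain ⟨h1, h2⟩ := List.forall_mem_cons.1 h.arc
  exact exists_directed_of_horizontal _ h1 (h2 _ (List.mem_singleton_self _))

theorem directed_infinity {o : TPoint infinity.n → Bool} (h : infinity.IsOpenOrientation o) :
    ∃ c, Directed (fun d => o (none, d)) c ∧ (c = .ne ∨ c = .se) := by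
  obtain ⟨h1, h2⟩ := List.forall_mem_cons.1 h.arc
  exact exists_directed_of_vertical _ h1 (h2 _ (List.mem_singleton_self _))

/-- The directions at the end points determine the writhe of a twisted tangle. -/
theorem IsTwisted.writhe_eq {w : List Bool} {D : TangleDiagram} (hw : IsTwisted w D)
    {o : TPoint D.n → Bool} (ho : D.IsOpenOrientation o) :
    ∃ c, Directed (fun d => o (none, d)) c ∧ endSign (run w c) ≠ 0 ∧
      D.writhe o = signSum w c + endSign (run w c) := by
  induction hw with
  | right_zero =>
    obtain ⟨c, hc, h⟩ := directed_zero (IsOpenOrientation.of_addRight ho).1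
    obtain ⟨h1, h2⟩ := directed_addRight ho hc
    refine ⟨_, h1, ?_, h2.trans ?_⟩
    · rcases h with rfl | rfl <;> simp [run, turn, endSign]
    · have : zero.writhe (fun P => o (shiftRight P)) = 0 := Fin.sum_univ_zero _
      rw [this]
      rcases h with rfl | rfl <;> simp [run, turn, endSign, signSum, letterSign]
  | below_infinity =>
    obtain ⟨c, hc, h⟩ := directed_infinity (IsOpenOrientation.of_addBelow ho).1
    obtain ⟨h1, h2⟩ := directed_addBelow ho hc
    refine ⟨_, h1, ?_, h2.trans ?_⟩
    · rcases h with rfl | rfl <;> simp [run, turn, endSign]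
    · have : infinity.writhe (fun P => o (shiftBelow P)) = 0 := Fin.sum_univ_zero _
      rw [this]
      rcases h with rfl | rfl <;> simp [run, turn, endSign, signSum, letterSign]
  | addBelow _ ih =>
    obtain ⟨c, hc, h3, h4⟩ := ih (IsOpenOrientation.of_addBelow ho).1
    obtain ⟨h1, h2⟩ := directed_addBelow ho hc
    refine ⟨_, h1, by rwa [run, turn_turn], h2.trans ?_⟩
    rw [h4, run, signSum, turn_turn, add_assoc]
  | addRight _ ih =>
    obtain ⟨c, hc, h3, h4⟩ := ih (IsOpenOrientation.of_addRight ho).1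
    obtain ⟨h1, h2⟩ := directed_addRight ho hc
    refine ⟨_, h1, by rwa [run, turn_turn], h2.trans ?_⟩
    rw [h4, run, signSum, turn_turn, add_assoc]

/-- The writhe of the diagram of the word `true :: w`, as a sum along the path of the corner `c`
under the letters of `w`; the first summand belongs to the letter `true`. -/
def pathSign (w : List Bool) (c : Corner) : ℤ :=
  endSign c + signSum w c + endSign (run w c)

theorem run_append (w w' : List Bool) (c : Corner) : run (w ++ w') c = run w' (run w c) := by
  induction w generalizing c with
  | nil => rfl
  | cons b w ih => exact ih _

theorem signSum_append (w w' : List Bool) (c : Corner) :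
    signSum (w ++ w') c = signSum w c + signSum w' (run w c) := by
  induction w generalizing c with
  | nil => simp [signSum, run]
  | cons b w ih => simp only [List.cons_append, signSum, run, ih, add_assoc]

theorem letterSign_turn (b : Bool) (c : Corner) :
    letterSign b (turn b c) = letterSign b c := by
  cases b <;> cases c <;> rfl

/-- The reversed word runs through the path of a corner backwards. -/
theorem run_reverse (w : List Bool) (c : Corner) : run w.reverse (run w c) = c := by
  induction w generalizing c with
  | nil => rfl
  | cons b w ih =>
    rw [List.reverse_cons, run_append, show run (b :: w) c = run w (turn b c) from rfl, ih, run,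
      run, turn_turn]

theorem signSum_reverse (w : List Bool) (c : Corner) :
    signSum w.reverse (run w c) = signSum w c := by
  induction w generalizing c with
  | nil => rfl
  | cons b w ih =>
    rw [List.reverse_cons, signSum_append, run, ih, run_reverse, signSum, signSum,
      signSum, letterSign_turn, add_zero, add_comm]

theorem pathSign_reverse (w : List Bool) (c : Corner) :
    pathSign w.reverse (run w c) = pathSign w c := by
  rw [pathSign, pathSign, signSum_reverse, run_reverse]
  ring

/-- The reflection in the diagonal through `nw` and `se`. -/
def reflect : Corner → Corner
  | .nw => .nw
  | .ne => .sw
  | .sw => .ne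
  | .se => .se

theorem run_map_not (w : List Bool) (c : Corner) :
    run (w.map not) (reflect c) = reflect (run w c) := by
  induction w generalizing c with
  | nil => rfl
  | cons b w ih =>
    rw [List.map_cons, run, run, ← ih]
    cases b <;> cases c <;> rfl

theorem signSum_map_not (w : List Bool) (c : Corner) :
    signSum (w.map not) (reflect c) = -signSum w c := by
  induction w generalizing c with
  | nil => rfl
  | cons b w ih =>
    rw [List.map_cons, signSum, signSum, neg_add, ← ih]
    cases b <;> cases c <;> rfl

theorem endSign_reflect (c : Corner) : endSign (reflect c) = -endSign c := by
  cases c <;> rfl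

theorem pathSign_map_not (w : List Bool) (c : Corner) :
    pathSign (w.map not) (reflect c) = -pathSign w c := by
  rw [pathSign, pathSign, signSum_map_not, run_map_not, endSign_reflect, endSign_reflect]
  ring

/-! ### The modular action of words, and parities -/

/-- The action of a word on pairs of numbers, which are regarded as fractions. -/
def act : List Bool → ℕ × ℕ → ℕ × ℕ
  | [], v => v
  | true :: w, v => ((act w v).1, (act w v).1 + (act w v).2)
  | false :: w, v => ((act w v).1 + (act w v).2, (act w v).2)

theorem act_append (w w' : List Bool) (v : ℕ × ℕ) : act (w ++ w') v = act w (act w' v) := by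
  induction w with
  | nil => rfl
  | cons b w ih => cases b <;> simp only [List.cons_append, act, ih]

theorem act_add (w : List Bool) (v v' : ℕ × ℕ) : act w (v + v') = act w v + act w v' := by
  induction w with
  | nil => rfl
  | cons b w ih =>
    cases b <;> ext <;> simp only [act, ih, Prod.fst_add, Prod.snd_add] <;> ring

theorem frac_eq_act (w : List Bool) : frac w = act w (1, 0) + act w (0, 1) := by
  rw [← act_add]
  induction w with
  | nil => rfl
  | cons b w ih => cases b <;> simp only [frac, act, ih]

theorem act_det (w : List Bool) :
    (act w (1, 0)).1 * (act w (0, 1)).2 = (act w (0, 1)).1 * (act w (1, 0)).2 + 1 := by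
  induction w with
  | nil => rfl
  | cons b w ih => cases b <;> simp only [act] <;> linear_combination ih

/-- Reversing a word reflects its matrix in the antidiagonal. -/
theorem act_reverse (w : List Bool) :
    act w.reverse (1, 0) = ((act w (0, 1)).2, (act w (1, 0)).2) ∧
      act w.reverse (0, 1) = ((act w (0, 1)).1, (act w (1, 0)).1) := by
  induction w with
  | nil => exact ⟨rfl, rfl⟩
  | cons b w ih =>
    have h : act w.reverse (1, 1) = act w.reverse (1, 0) + act w.reverse (0, 1) := by
      rw [← act_add]; rfl
    rw [List.reverse_cons, act_append, act_append]
    cases b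
    · have e1 : act [false] (1, 0) = (1, 0) := rfl
      have e2 : act [false] (0, 1) = (1, 1) := rfl
      rw [e1, e2, h, ih.1, ih.2]
      constructor <;> ext <;> simp only [act, Prod.mk_add_mk] <;> ring
    · have e1 : act [true] (1, 0) = (1, 1) := rfl
      have e2 : act [true] (0, 1) = (0, 1) := rfl
      rw [e1, e2, h, ih.1, ih.2]
      constructor <;> ext <;> simp only [act, Prod.mk_add_mk] <;> ring

theorem act_map_not (w : List Bool) (v : ℕ × ℕ) : act (w.map not) v.swap = (act w v).swap := by
  induction w with
  | nil => rfl
  | cons b w ih =>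
    cases b <;> ext <;> simp only [List.map_cons, act, Bool.not_true, Bool.not_false, ih,
      Prod.fst_swap, Prod.snd_swap] <;> ring

/-- The corner which is joined to `nw` by a strand of a tangle with the fraction `p/q`. -/
def parityCorner (v : ℕ × ℕ) : Corner :=
  if Even v.1 then if Even v.2 then .nw else .ne else if Even v.2 then .sw else .se

theorem run_parityCorner (w : List Bool) (v : ℕ × ℕ) :
    run w (parityCorner (act w v)) = parityCorner v := by
  induction w with
  | nil => rfl
  | cons b w ih =>
    rw [run, ← ih]
    congr 1
    cases b <;> by_cases h1 : Even (act w v).1 <;> by_cases h2 : Even (act w v).2 <;>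
      simp [parityCorner, act, turn, h1, h2, Nat.even_add]

/-- The corner at which the path of the word of the fraction `p/q` starts. -/
def startCorner (p q : ℕ) : Corner :=
  if Odd p ∧ Odd q then .ne else .sw

end TangleDiagram

/-! ### The invariants of a rational number in terms of its word -/

namespace TangleDiagram

/-- For a knot, the path of the word of `p/q` ends where that of the word of `r/q` starts. -/
theorem run_startCorner_of_odd (w : List Bool) {p q : ℕ} (h : frac (true :: w) = (p, q))
    (hq : Odd q) :
    run w (startCorner p q) =
      startCorner ((act w (0, 1)).1 + (act w (0, 1)).2) q := by
  have h1 := run_parityCorner w (1, 0)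
  have h2 := run_parityCorner w (0, 1)
  have hdet : Even ((act w (1, 0)).1 * (act w (0, 1)).2) ↔
      ¬ Even ((act w (0, 1)).1 * (act w (1, 0)).2) := by
    rw [act_det, Nat.even_add_one]
  rw [frac, frac_eq_act, Prod.mk.injEq] at h
  obtain ⟨rfl, rfl⟩ := h
  generalize act w (1, 0) = v at *
  generalize act w (0, 1) = v' at *
  obtain ⟨a, c⟩ := v
  obtain ⟨b, d⟩ := v'
  simp only [Prod.mk_add_mk, Nat.even_add, Nat.even_mul, startCorner, parityCorner,
    ← Nat.not_even_iff_odd] at *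
  by_cases ha : Even a <;> by_cases hb : Even b <;> by_cases hc : Even c <;>
    by_cases hd : Even d <;> simp_all [-Nat.not_even_iff_odd]

/-- For a link with two components, the end of the path depends on the parity of the numerator `x` of
the first parent. -/
theorem run_sw_of_even (w : List Bool) {p q : ℕ} (h : frac (true :: w) = (p, q)) (hq : Even q) :
    run w .sw = if Even (act w (0, 1)).1 then .sw else .ne := by
  have h1 := run_parityCorner w (1, 0)
  have h2 := run_parityCorner w (0, 1)
  have hdet : Even ((act w (1, 0)).1 * (act w (0, 1)).2) ↔
      ¬ Even ((act w (0, 1)).1 * (act w (1, 0)).2) := by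
    rw [act_det, Nat.even_add_one]
  rw [frac, frac_eq_act, Prod.mk.injEq] at h
  obtain ⟨rfl, rfl⟩ := h
  generalize act w (1, 0) = v at *
  generalize act w (0, 1) = v' at *
  obtain ⟨a, c⟩ := v
  obtain ⟨b, d⟩ := v'
  simp only [Prod.mk_add_mk, Nat.even_add, Nat.even_mul, parityCorner] at *
  by_cases ha : Even a <;> by_cases hb : Even b <;> by_cases hc : Even c <;>
    by_cases hd : Even d <;> simp_all [-Nat.not_even_iff_odd]

end TangleDiagram

namespace RationalDiagram

open TangleDiagram

variable {α : ℚ}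

theorem digits_ne_nil (D : RationalDiagram α) (h0 : α ≠ 0) : D.digits ≠ [] := fun h =>
  h0 (by rw [← D.value_eq, h, cfValue])

theorem cfWeight_eq (l : List ℕ) : cfWeight l = altSum l + if Odd l.length then 2 else 0 := by
  rw [cfWeight, altSum_eq]

theorem exists_word (D : RationalDiagram α) (h0 : α ≠ 0) :
    ∃ w, IsTwisted w D.tangle ∧ α = ((frac w).1 : ℚ) / (frac w).2 ∧ excess w = D.wt - 1 := by
  obtain ⟨⟨w, hw, hv, he⟩, -⟩ :=
    exists_isTwisted_build D.digits D.digits_pos (D.digits_ne_nil h0)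
  refine ⟨w, hw, D.value_eq.symm.trans hv, ?_⟩
  rw [he, wt, cfWeight_eq]
  split_ifs <;> ring

theorem eq_of_div_eq_div {v v' : ℕ × ℕ} (h : Nat.Coprime v.1 v.2) (h' : Nat.Coprime v'.1 v'.2)
    (hv : 0 < v.2) (hv' : 0 < v'.2) (e : (v.1 : ℚ) / v.2 = v'.1 / v'.2) : v = v' := by
  have h1 := Rat.div_int_inj (a := v.1) (b := v.2) (c := v'.1) (d := v'.2) (by exact_mod_cast hv)
    (by exact_mod_cast hv') (by simpa using h) (by simpa using h') (by simpa using e)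
  exact Prod.ext (by exact_mod_cast h1.1) (by exact_mod_cast h1.2)

/-- The word of a fraction in `(0,1)`, which begins with a twist below. -/
theorem exists_frac_eq {p q : ℕ} (D : RationalDiagram ((p : ℚ) / q)) (hp : 0 < p) (hpq : p < q)
    (hco : Nat.Coprime p q) : ∃ w, frac (true :: w) = (p, q) := by
  have hq : 0 < q := hp.trans hpq
  obtain ⟨w, -, h, -⟩ := D.exists_word (by positivity)
  have hw : (p, q) = frac w := eq_of_div_eq_div hco (frac_coprime w) hq (frac_pos w).2 h
  rcases w with _ | ⟨_ | _, w⟩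
  · simp only [frac, Prod.mk.injEq] at hw
    omega
  · simp only [frac, Prod.mk.injEq] at hw
    omega
  · exact ⟨w, hw.symm⟩

/-- The invariants of a diagram of the fraction of the word `true :: w`. They do not depend on the
chosen continued fraction and orientation: for odd `q`, the parities of `p` and `q` determine which
end points are directed alike, and for even `q`, the convention does. -/
theorem invariants_eq (D : RationalDiagram α) {w : List Bool} {p q : ℕ}
    (hw : frac (true :: w) = (p, q)) (hα : α = (p : ℚ) / q) :
    D.friezeBracket = friezePolynomial w ∧ D.wt = excess w ∧
      D.wr = pathSign w (startCorner p q) := by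
  have hpos := frac_pos (true :: w)
  have hco := frac_coprime (true :: w)
  rw [hw] at hpos hco
  dsimp only at hpos hco
  obtain ⟨hp, hq⟩ := hpos
  obtain ⟨w', htw, hα', he⟩ := D.exists_word (by rw [hα]; positivity)
  obtain rfl : true :: w = w' := frac_injective (by
    rw [hw]
    exact eq_of_div_eq_div hco (frac_coprime w') hq (frac_pos w').2 (hα.symm.trans hα'))
  have hwt : D.wt = excess w := by
    rw [excess] at he
    omega
  refine ⟨by rw [friezeBracket, hwt]; exact negACubed_mul_bracket htw, hwt, ?_⟩
  obtain ⟨c, hc, hrun, hwr⟩ := htw.writhe_eq (o := D.orient)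
    ⟨D.isOrientation.arc, D.isOrientation.strand_nw_se, D.isOrientation.strand_sw_ne⟩
  have h1 : D.orient (none, .nw) ≠ D.orient (none, .sw) :=
    D.isOrientation.closing _ List.mem_cons_self
  have hden : α.den = q := by
    have := Rat.den_div_eq_of_coprime (a := (p : ℤ)) (b := (q : ℤ)) (by exact_mod_cast hq)
      (by simpa using hco)
    rw [Int.cast_natCast, Int.cast_natCast, ← hα] at this
    exact_mod_cast this
  -- The path cannot end at `se`, hence it does not start at the corner with the parities of `p`
  -- and `q`.
  have h2 : c ≠ parityCorner (p, q) := by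
    rintro rfl
    have h := run_parityCorner (true :: w) (1, 1)
    have e : act (true :: w) (1, 1) = (p, q) := by
      rw [← hw, frac_eq_act, ← act_add]
      rfl
    rw [e] at h
    rw [h] at hrun
    exact hrun rfl
  have h3 : Even q → c ≠ .ne := by
    rintro h rfl
    have e1 := (hc.2 .sw).not.2 (by simp)
    have e2 := (hc.2 .se).not.2 (by simp)
    exact D.convention (by rwa [hden]) ((Bool.eq_not.2 e1).trans (Bool.eq_not.2 e2).symm)
  have h4 : turn true c = startCorner p q ∧ letterSign true c = endSign (turn true c) := by
    have h5 := not_even_and_even hco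
    simp only [startCorner, parityCorner, ← Nat.not_even_iff_odd] at h2 ⊢
    have h6 : c ≠ .sw := by
      rintro rfl
      exact h1 ((hc.2 .sw).2 (by simp)).symm
    have h7 := hc.1
    cases c <;> by_cases hp2 : Even p <;> by_cases hq2 : Even q <;>
      simp_all [turn, letterSign, endSign]
  rw [wr, hwr, signSum, run, h4.2, h4.1, pathSign]

theorem jones_eq (D : RationalDiagram α) :
    D.jones = negACubed (-D.wr - D.wt) * D.friezeBracket := by
  rw [friezeBracket, ← mul_assoc, ← negACubed_add, jones]
  congr 2
  ring

/-- The parents of a fraction are the images of `1/0` and `0/1` under its word. -/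
theorem _root_.IsFareyParents.eq_act {x r y s p q : ℕ} (h : IsFareyParents x r y s p q)
    (hco : Nat.Coprime p q) {w : List Bool} (hw : frac (true :: w) = (p, q)) (hs : 0 < s) :
    x = (act w (0, 1)).1 ∧ r = (act w (0, 1)).1 + (act w (0, 1)).2 ∧
      y = (act w (1, 0)).1 ∧ s = (act w (1, 0)).1 + (act w (1, 0)).2 := by
  obtain ⟨h1, h2, h3⟩ := h
  have hdet := act_det w
  rw [frac, frac_eq_act, Prod.mk.injEq] at hw
  obtain ⟨hp, hq⟩ := hw
  generalize act w (1, 0) = v at *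
  generalize act w (0, 1) = v' at *
  obtain ⟨a, c⟩ := v
  obtain ⟨b, d⟩ := v'
  simp only [Prod.mk_add_mk] at *
  have ha : 0 < a := by
    rcases Nat.eq_zero_or_pos a with rfl | h
    · simp at hdet
    · exact h
  have hd : 0 < d := by
    rcases Nat.eq_zero_or_pos d with rfl | h
    · simp at hdet
    · exact h
  have hr : 0 < r := by
    rcases Nat.eq_zero_or_pos r with rfl | h
    · simp at h1
    · exact h
  -- Both `r` and `b + d` are inverses of `p` modulo `q`.
  have key : ((r : ℤ) - (b + d)) * p = (x - b) * q := by
    have e1 : (r * y : ℤ) = x * s + 1 := by exact_mod_cast h1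
    have e2 : (a * d : ℤ) = b * c + 1 := by exact_mod_cast hdet
    have e3 : (p : ℤ) = x + y := by exact_mod_cast h2
    have e4 : (q : ℤ) = r + s := by exact_mod_cast h3
    have e5 : (p : ℤ) = a + b := by exact_mod_cast hp.symm
    have e6 : (q : ℤ) = a + b + (c + d) := by exact_mod_cast hq.symm
    linear_combination e1 - e2 + r * e3 - x * e4 - (b + d) * e5 + b * e6
  have hdvd : (q : ℤ) ∣ r - (b + d) :=
    (Int.isCoprime_iff_gcd_eq_one.2 (by simpa using hco.symm)).dvd_of_dvd_mul_right
      ⟨_, key.trans (mul_comm _ _)⟩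
  have hr' : (r : ℤ) - (b + d) = 0 := Int.eq_zero_of_abs_lt_dvd hdvd (by rw [abs_lt]; omega)
  have hx : ((x : ℤ) - b) = 0 := by
    rw [hr', zero_mul, eq_comm, mul_eq_zero] at key
    rcases key with h | h
    · exact h
    · omega
  omega

end RationalDiagram

open TangleDiagram in
/-- Write `α = p/q` in `(0,1)` with parents `x/r < y/s`; then `i(α) = (q-p)/q`, `r(α) = r/q` and
`(ir)(α) = s/q`, and `LaurentPolynomial.invert` replaces `A` by `A⁻¹`. -/
theorem theorem4p6 (p q x r y s : ℕ) (hp : 0 < p) (hpq : p < q) (hco : Nat.Coprime p q)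
    (hpar : IsFareyParents x r y s p q)
    (D : RationalDiagram ((p : ℚ) / q)) (Di : RationalDiagram (((q : ℚ) - p) / q))
    (Dr : RationalDiagram ((r : ℚ) / q)) (Dir : RationalDiagram ((s : ℚ) / q)) :
    (D.friezeBracket, Di.friezeBracket, Dr.friezeBracket, Dir.friezeBracket) =
        (D.friezeBracket, LaurentPolynomial.invert D.friezeBracket,
          D.friezeBracket, LaurentPolynomial.invert D.friezeBracket) ∧
      (Odd q →
        Di.jones = LaurentPolynomial.invert D.jones ∧
        Dir.jones = LaurentPolynomial.invert D.jones ∧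
        Dr.jones = D.jones) ∧
      (Even q → Even x →
        Di.jones = negACubed (-D.wr - Di.wr) * LaurentPolynomial.invert D.jones ∧
        Dir.jones = negACubed (-D.wr - Di.wr) * LaurentPolynomial.invert D.jones ∧
        Dr.jones = D.jones) ∧
      (Even q → Even y →
        Di.jones = negACubed (-D.wr - Di.wr) * LaurentPolynomial.invert D.jones ∧
        Dir.jones = LaurentPolynomial.invert D.jones ∧
        Dr.jones = negACubed (D.wr + Di.wr) * D.jones) := by
  obtain ⟨w, hw⟩ := D.exists_frac_eq hp hpq hco
  have hs : 0 < s := by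
    rcases Nat.eq_zero_or_pos s with rfl | h
    · have h1 := hpar.neighbors
      have h2 := hpar.den
      rw [mul_zero, zero_add, mul_eq_one] at h1
      omega
    · exact h
  obtain ⟨hx, hr, hy, hs⟩ := hpar.eq_act hco hw hs
  have hp2 := hpar.num
  have hq2 := hpar.den
  -- The words of the other three fractions; `eq_act` identifies the matrix entries.
  have hwr : frac (true :: w.reverse) = (r, q) := by
    obtain ⟨e1, e2⟩ := act_reverse w
    rw [frac, frac_eq_act, e1, e2]
    ext <;> simp only [Prod.mk_add_mk] <;> omega
  have hwi : frac (true :: w.map not) = (q - p, q) := by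
    have e1 : act (w.map not) (1, 0) = _ := act_map_not w (0, 1)
    have e2 : act (w.map not) (0, 1) = _ := act_map_not w (1, 0)
    rw [frac, frac_eq_act, e1, e2]
    ext <;> simp only [Prod.fst_add, Prod.snd_add, Prod.fst_swap, Prod.snd_swap] <;> omega
  have hwir : frac (true :: w.reverse.map not) = (s, q) := by
    have e1 : act (w.reverse.map not) (1, 0) = _ := act_map_not w.reverse (0, 1)
    have e2 : act (w.reverse.map not) (0, 1) = _ := act_map_not w.reverse (1, 0)
    obtain ⟨e3, e4⟩ := act_reverse w
    rw [frac, frac_eq_act, e1, e2, e3, e4]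
    ext <;> simp only [Prod.fst_add, Prod.snd_add, Prod.fst_swap, Prod.snd_swap] <;> omega
  obtain ⟨hF, hwt, hwr'⟩ := D.invariants_eq hw rfl
  obtain ⟨hFi, hwti, hwri⟩ := Di.invariants_eq hwi (by rw [Nat.cast_sub hpq.le])
  obtain ⟨hFr, hwtr, hwrr⟩ := Dr.invariants_eq hwr rfl
  obtain ⟨hFir, hwtir, hwrir⟩ := Dir.invariants_eq hwir rfl
  rw [friezePolynomial_map_not, ← hF] at hFi
  rw [friezePolynomial_reverse, ← hF] at hFr
  rw [friezePolynomial_map_not, friezePolynomial_reverse, ← hF] at hFir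
  rw [excess_map_not, ← hwt] at hwti
  rw [excess_reverse, ← hwt] at hwtr
  rw [excess_map_not, excess_reverse, ← hwt] at hwtir
  have hinv : LaurentPolynomial.invert D.jones =
      negACubed (D.wr + D.wt) * LaurentPolynomial.invert D.friezeBracket := by
    rw [D.jones_eq, map_mul, invert_negACubed]
    congr 2
    ring
  rw [hinv, Di.jones_eq, Dr.jones_eq, Dir.jones_eq, D.jones_eq, hFi, hFr, hFir, hwti, hwtr, hwtir]
  simp only [← mul_assoc, ← negACubed_add]
  refine ⟨trivial, fun hq => ?_, fun hq hx2 => ?_, fun hq hy2 => ?_⟩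
  · have hrun := run_startCorner_of_odd w hw hq
    rw [← hr] at hrun
    have ei : startCorner (q - p) q = reflect (startCorner p q) := by
      simp only [startCorner, Nat.odd_sub hpq.le]
      by_cases h : Even p <;> simp_all [reflect, ← Nat.not_even_iff_odd]
    have eir : startCorner s q = reflect (startCorner r q) := by
      rw [hq2, Nat.odd_add] at hq
      simp only [startCorner, hq2, Nat.odd_add]
      by_cases h : Even r <;> by_cases h' : Even s <;>
        simp_all [reflect, ← Nat.not_even_iff_odd]
    rw [ei, pathSign_map_not, ← hwr'] at hwri
    rw [← hrun, pathSign_reverse, ← hwr'] at hwrr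
    rw [eir, pathSign_map_not, ← hrun, pathSign_reverse, ← hwr'] at hwrir
    refine ⟨?_, ?_, ?_⟩ <;> congr 2 <;> omega
  all_goals
    have hst (p' : ℕ) : startCorner p' q = .sw :=
      if_neg fun h => Nat.not_even_iff_odd.2 h.2 hq
    have hrun := run_sw_of_even w hw hq
    have hruni := run_sw_of_even _ hwi hq
    have ei : (act (w.map not) (0, 1)).1 + y = s := by
      have e : act (w.map not) (0, 1) = _ := act_map_not w (1, 0)
      rw [e, Prod.fst_swap]
      omega
    have hp3 : ¬ Even p := fun h => not_even_and_even hco ⟨h, hq⟩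
    have hdet : Even (r * y) ↔ ¬ Even (x * s) := by rw [hpar.neighbors, Nat.even_add_one]
    rw [hq2, Nat.even_add] at hq
    rw [hp2, Nat.even_add] at hp3
    rw [Nat.even_mul, Nat.even_mul] at hdet
    rw [hst] at hwr' hwri hwrr hwrir
    rw [← hx] at hrun
    have e1 := pathSign_reverse w .sw
    have e2 := pathSign_reverse (w.map not) .sw
    have hs2 : (Even (act (w.map not) (0, 1)).1 ↔ Even y) ↔ Even s := by rw [← ei, Nat.even_add]
  · rw [if_pos hx2] at hrun
    rw [if_pos (by tauto)] at hruni
    rw [hrun] at e1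
    rw [hruni, ← List.map_reverse] at e2
    refine ⟨?_, ?_, ?_⟩ <;> congr 2 <;> omega
  · rw [if_neg (by tauto)] at hrun hruni
    rw [hrun] at e1
    rw [hruni, ← List.map_reverse] at e2
    have e3 : pathSign (w.reverse.map not) .ne = _ := pathSign_map_not w.reverse .sw
    have e4 : pathSign (w.reverse.map not) .sw = _ := pathSign_map_not w.reverse .ne
    refine ⟨?_, ?_, ?_⟩ <;> congr 2 <;> omega
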